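/- Let $M$ be a connected (Hausdorff) smooth manifold of dimension $n\ge 2$ and let $F:TM\to[0,\infty)$ be a Finsler structure on $M$: $F$ is $C^\infty$ on the slit tangent bundle $TM_0$, $F(x,\lambda y)=\lambda F(x,y)$ for $\lambda>0$, and the matrix $g_{ij}=[\tfrac12F^2]_{y^iy^j}$ is positive definite on $TM_0$. Put $G^i=\tfrac12 g^{il}\big([F^2]_{x^ky^l}y^k-[F^2]_{x^l}\big)$; the geodesics $x(s)$ with arc-length parameter $s$ are the curves with $F(x,\frac{dx}{ds})=1$ and $\frac{d^2x^i}{ds^2}+G^i(x,\frac{dx}{ds})=0$. The Ricci scalar $Ric=R^i{}_i$ is the trace of the Riemann curvature $$2F^2R^i{}_k=2(G^i)_{x^k}-\tfrac12(G^i)_{y^j}(G^j)_{y^k}-y^j(G^i)_{y^kx^j}+G^j(G^i)_{y^ky^j},$$ and the Ricci tensor is $Ric_{ik}=\tfrac12(F^2Ric)_{y^iy^k}$. A projective parameter of a geodesic $x(s)$ is a function $\pi(s)$ with $\pi'\neq0$ and $$\{\pi,s\}:=\frac{\pi'''}{\pi'}-\frac32\Big(\frac{\pi''}{\pi'}\Big)^2=\frac{2}{n-1}Ric_{jk}\frac{dx^j}{ds}\frac{dx^k}{ds}.$$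 Let $I=(-1,1)$, with the Poincaré distance $\rho(a,b)=\big|\ln\frac{(1-a)(1+b)}{(1-b)(1+a)}\big|$. A projective map $f:I\to M$ is a geodesic, up to parametrization, whose natural parameter $u\in I$ is a projective parameter. For $x,y\in M$ let $d_M(x,y)$ be the infimum of $\sum_{i=1}^k\rho(a_i,b_i)$ over all chains consisting of points $x=x_0,x_1,\dots,x_k=y$ of $M$ ($k\ge1$), pairs $a_i,b_i\in I$ and projective maps $f_i:I\to M$ with $f_i(a_i)=x_{i-1}$ and $f_i(b_i)=x_i$ for $i=1,\dots,k$ (the infimum being $\infty$ if there is no chain). Suppose that $(M,F)$ is complete, in the sense that every geodesic parametrized by arc length extends to a geodesic with arc-length parameter $-\infty<s<\infty$, and that the Ricci tensor is positive semi-definite, i.e. $Ric_{ij}(x,y)w^iw^j\ge0$ for all $(x,y)\in TM_0$ and all $w$. Then every two points of $M$ are joined by a chain, and $d_M(x,y)=0$ for all $x,y\in M$. -/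

import Mathlib

open Set
open scoped Manifold ContDiff Topology ENNReal

noncomputable section

namespace Finsler

/-- The coordinate space `ℝⁿ`. -/
abbrev Coord (n : ℕ) : Type := EuclideanSpace ℝ (Fin n)

/-- The partial derivative `∂f/∂xⁱ` of a function `f(x, y)`. -/
def dX {n : ℕ} (i : Fin n) (f : Coord n → Coord n → ℝ) : Coord n → Coord n → ℝ :=
  fun x y => fderiv ℝ (fun z => f z y) x (EuclideanSpace.single i 1)

/-- The partial derivative `∂f/∂yⁱ` of a function `f(x, y)`. -/
def dY {n : ℕ} (i : Fin n) (f : Coord n → Coord n → ℝ) : Coord n → Coord n → ℝ :=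
  fun x y => fderiv ℝ (fun z => f x z) y (EuclideanSpace.single i 1)

/-! ### Coordinate formulas, for a function `L(x, y)` that represents `F` in a chart -/

/-- The fundamental tensor `g_{ij} = [½ F²]_{yⁱ yʲ}`. -/
def metricMatrix {n : ℕ} (L : Coord n → Coord n → ℝ) (x y : Coord n) :
    Matrix (Fin n) (Fin n) ℝ :=
  Matrix.of fun i j => dY i (dY j (fun x y => 1 / 2 * L x y ^ 2)) x y

/-- The spray coefficients `Gⁱ = ½ g^{il} ([F²]_{xᵏ yˡ} yᵏ - [F²]_{xˡ})`. -/
def sprayCoeff {n : ℕ} (L : Coord n → Coord n → ℝ) (i : Fin n) (x y : Coord n) : ℝ :=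
  1 / 2 * ∑ l, (metricMatrix L x y)⁻¹ i l *
    ((∑ k, dX k (dY l (fun x y => L x y ^ 2)) x y * y k) - dX l (fun x y => L x y ^ 2) x y)

/-- The Riemann curvature `Rⁱₖ` (homogeneous of degree `0` in `y`), given by
`2 F² Rⁱₖ = 2 (Gⁱ)_{xᵏ} - ½ (Gⁱ)_{yʲ} (Gʲ)_{yᵏ} - yʲ (Gⁱ)_{yᵏ xʲ} + Gʲ (Gⁱ)_{yᵏ yʲ}`. -/
def riemannCurvature {n : ℕ} (L : Coord n → Coord n → ℝ) (i k : Fin n) (x y : Coord n) : ℝ :=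
  (2 * dX k (sprayCoeff L i) x y
    - 1 / 2 * ∑ j, dY j (sprayCoeff L i) x y * dY k (sprayCoeff L j) x y
    - ∑ j, y j * dX j (dY k (sprayCoeff L i)) x y
    + ∑ j, sprayCoeff L j x y * dY j (dY k (sprayCoeff L i)) x y) / (2 * L x y ^ 2)

/-- The Ricci scalar `Ric = Rⁱᵢ`. -/
def ricciScalar {n : ℕ} (L : Coord n → Coord n → ℝ) (x y : Coord n) : ℝ :=
  ∑ i, riemannCurvature L i i x y

/-- The Ricci tensor `Ric_{ik} = ½ (F² Ric)_{yⁱ yᵏ}`. -/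
def ricciTensor {n : ℕ} (L : Coord n → Coord n → ℝ) (i k : Fin n) (x y : Coord n) : ℝ :=
  1 / 2 * dY i (dY k (fun x y => L x y ^ 2 * ricciScalar L x y)) x y

/-! ### Finsler structures -/

section Manifold

variable {n : ℕ} {M : Type*} [TopologicalSpace M] [ChartedSpace (Coord n) M]
  [IsManifold (𝓡 n) ∞ M]

/-- The expression `F(x, y)` of a function on `TM` in the standard coordinates `(xⁱ, yⁱ)` of `TM`
induced by the chart around `p` (the chart of `TM` at the zero vector of `T_p M`, which covers the
tangent spaces at all points of the chart domain): here `x` is the coordinate vector of a point of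
the chart domain (so `x` lies in the target of the chart), and `y` is the coordinate vector of a
tangent vector at that point. -/
def localExpr (F : TangentBundle (𝓡 n) M → ℝ) (p : M) (x y : Coord n) : ℝ :=
  F ((extChartAt (𝓡 n).tangent (⟨p, 0⟩ : TangentBundle (𝓡 n) M)).symm (x, y))

end Manifold

/-- A (globally defined) Finsler structure on the `n`-dimensional manifold `M`. -/
structure FinslerStructure (n : ℕ) (M : Type*) [TopologicalSpace M] [ChartedSpace (Coord n) M]
    [IsManifold (𝓡 n) ∞ M] where
  /-- The function `F : TM → [0, ∞)`. -/
  toFun : TangentBundle (𝓡 n) M → ℝ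
  nonneg : ∀ v, 0 ≤ toFun v
  /-- Regularity: `F` is smooth on the slit tangent bundle. -/
  smooth : ContMDiffOn (𝓡 n).tangent 𝓘(ℝ, ℝ) ∞ toFun {v | v.2 ≠ 0}
  /-- Positive homogeneity. -/
  homogeneous : ∀ (x : M) (v : TangentSpace (𝓡 n) x) (c : ℝ), 0 < c →
    toFun ⟨x, c • v⟩ = c * toFun ⟨x, v⟩
  /-- Strong convexity: `(g_{ij})` is positive definite on the slit tangent bundle. -/
  strongly_convex : ∀ (p : M) (x y : Coord n), x ∈ (extChartAt (𝓡 n) p).target → y ≠ 0 →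
    (metricMatrix (localExpr toFun p) x y).PosDef

namespace FinslerStructure

variable {n : ℕ} {M : Type*} [TopologicalSpace M] [ChartedSpace (Coord n) M]
  [IsManifold (𝓡 n) ∞ M] (F : FinslerStructure n M)

/-- The expression of `F` in the coordinates around `p`. -/
def inChart (p : M) : Coord n → Coord n → ℝ := localExpr F.toFun p

/-- The Ricci tensor is positive semi-definite: `Ric_{ij}(x, y) wⁱ wʲ ≥ 0` for every `(x, y)` in
the slit tangent bundle and every `w`. -/
def RicciPosSemidef : Prop :=
  ∀ (p : M) (x y : Coord n), x ∈ (extChartAt (𝓡 n) p).target → y ≠ 0 →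
    ∀ w : Coord n, 0 ≤ ∑ i, ∑ j, ricciTensor (F.inChart p) i j x y * w i * w j

/-- The curve `γ` in the coordinates around `p`. -/
def curveInChart (p : M) (γ : ℝ → M) : ℝ → Coord n := fun s => extChartAt (𝓡 n) p (γ s)

/-- `γ` is, on the open set `J`, a geodesic parametrized by arc length: in local coordinates
`F(x, dx/ds) = 1` and `d²xⁱ/ds² + Gⁱ(x, dx/ds) = 0`. -/
def IsGeodesicOn (γ : ℝ → M) (J : Set ℝ) : Prop :=
  ContMDiffOn 𝓘(ℝ, ℝ) (𝓡 n) 2 γ J ∧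
  ∀ s ∈ J, ∀ p : M, γ s ∈ (chartAt (Coord n) p).source →
    F.inChart p (curveInChart p γ s) (deriv (curveInChart p γ) s) = 1 ∧
    ∀ i, deriv (deriv (curveInChart p γ)) s i +
      sprayCoeff (F.inChart p) i (curveInChart p γ s) (deriv (curveInChart p γ) s) = 0

/-- Completeness (in both directions): every geodesic, parametrized by arc length on an open
interval, extends to a geodesic whose arc-length parameter runs over `(-∞, ∞)`. -/
def IsComplete : Prop :=
  ∀ (J : Set ℝ) (γ : ℝ → M), IsOpen J → J.OrdConnected → J.Nonempty → F.IsGeodesicOn γ J →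
    ∃ γ' : ℝ → M, F.IsGeodesicOn γ' univ ∧ EqOn γ' γ J

end FinslerStructure

/-- The Schwarzian derivative `{π, s}`. -/
def schwarzian (π : ℝ → ℝ) (s : ℝ) : ℝ :=
  iteratedDeriv 3 π s / deriv π s - 3 / 2 * (iteratedDeriv 2 π s / deriv π s) ^ 2

/-- The Poincaré distance on the interval `(-1, 1)`. -/
def poincareDist (a b : ℝ) : ℝ :=
  |Real.log ((1 - a) * (1 + b) / ((1 - b) * (1 + a)))|

namespace FinslerStructure

variable {n : ℕ} {M : Type*} [TopologicalSpace M] [ChartedSpace (Coord n) M]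
  [IsManifold (𝓡 n) ∞ M] (F : FinslerStructure n M)

/-- `π` is, on the open set `J`, a projective parameter of the geodesic `γ` (with arc-length
parameter `s`): `{π, s} = 2/(n-1) Ric_{jk} dxʲ/ds dxᵏ/ds`. -/
def IsProjectiveParameter (γ : ℝ → M) (J : Set ℝ) (π : ℝ → ℝ) : Prop :=
  ContDiffOn ℝ 3 π J ∧ (∀ s ∈ J, deriv π s ≠ 0) ∧
  ∀ s ∈ J, ∀ p : M, γ s ∈ (chartAt (Coord n) p).source →
    schwarzian π s = 2 / ((n : ℝ) - 1) *
      ∑ j, ∑ k, ricciTensor (F.inChart p) j k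
        (curveInChart p γ s) (deriv (curveInChart p γ) s) *
        deriv (curveInChart p γ) s j * deriv (curveInChart p γ) s k

/-- `f : (-1, 1) → M` is a projective map: a geodesic whose natural parameter `u ∈ (-1, 1)` is a
projective parameter. That is, `f` is a reparametrization of a geodesic `γ` with arc-length
parameter in an open interval `J`, and the change of parameter `u = π(s)` is a bijection of `J`
onto `(-1, 1)` that is a projective parameter of `γ`. Only the values of `f` on `(-1, 1)` matter. -/
def IsProjectiveMap (f : ℝ → M) : Prop :=
  ∃ (J : Set ℝ) (γ : ℝ → M) (π : ℝ → ℝ), IsOpen J ∧ J.OrdConnected ∧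
    F.IsGeodesicOn γ J ∧ F.IsProjectiveParameter γ J π ∧
    BijOn π J (Ioo (-1) 1) ∧ ∀ s ∈ J, f (π s) = γ s

/-- A chain of geodesic segments from `x` to `y`. -/
structure GeodesicChain (x y : M) where
  /-- The number of segments. -/
  k : ℕ
  k_pos : 0 < k
  /-- The points `x₀, …, xₖ`. -/
  pt : Fin (k + 1) → M
  /-- The initial parameters, in `(-1, 1)`. -/
  a : Fin k → ℝ
  /-- The final parameters, in `(-1, 1)`. -/
  b : Fin k → ℝ
  /-- The projective maps. -/
  f : Fin k → ℝ → M
  pt_zero : pt 0 = x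
  pt_last : pt (Fin.last k) = y
  a_mem : ∀ i, a i ∈ Ioo (-1 : ℝ) 1
  b_mem : ∀ i, b i ∈ Ioo (-1 : ℝ) 1
  projective : ∀ i, F.IsProjectiveMap (f i)
  map_a : ∀ i, f i (a i) = pt i.castSucc
  map_b : ∀ i, f i (b i) = pt i.succ

/-- The length of a chain. -/
def GeodesicChain.length {F : FinslerStructure n M} {x y : M} (α : F.GeodesicChain x y) : ℝ :=
  ∑ i, poincareDist (α.a i) (α.b i)

/-- The intrinsic pseudo-distance `d_M(x, y)`: the infimum of the (nonnegative) lengths of all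
chains of geodesic segments from `x` to `y`. It is `∞` if there is no such chain. -/
def pseudoDist (x y : M) : ℝ≥0∞ :=
  ⨅ α : F.GeodesicChain x y, ENNReal.ofReal α.length

end FinslerStructure

end Finsler

end

/-! Along a complete unit-speed geodesic γ put Q = Ric(γ', γ')/(n-1), which is continuous and
nonnegative. Projective parameters solve {π, s} = 2Q, and one of them is π = (1/R) ∫ₐ u⁻², where u''
= -Qu, u(a) = 1, u'(a) = 0 and R is arbitrary. Since Q ≥ 0, u stays at most 1. Hence on each side of
a the integral of u⁻² reaches R before u vanishes: near a zero u is at most linear in the distance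
to it, so the integral diverges there, and without a zero the integrand is at least 1 for all time.
So π maps an interval around a onto (-1, 1), whereas |π| ≤ 1/R on a δ-neighbourhood of a with δ
independent of R. Letting R tend to infinity joins γ(a) and γ(b), for |b - a| ≤ δ, by segments of
arbitrarily small length. This is `exists_schwarzian_eq` and `IsGeodesicOn.exists_shortlyJoined`.

The rest is connectedness, applied to the transitive closure of `ShortlyJoined`: first on the real
line, to reach all of γ (`IsGeodesicOn.transGen`), then on M (`transGen_shortlyJoined`), because all
points near p lie on complete geodesics through p. Those come from a two-point boundary value
problem solved by contraction (`exists_boundary_value`), followed by completeness.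

Geodesics and projective parameters are tested in every chart, so the objects involved must be shown
independent of coordinates. The spray is characterised by the Euler-Lagrange identity
`hessian_spray`, which yields its transformation law. Differentiating that law gives the
tensoriality of the curvature (`curvatureOp_tangentLift`), and taking the trace and then the
vertical Hessian gives that of the Ricci tensor (`ricciTensor_sum_tangentLift`). -/

noncomputable section

namespace Finsler

/-! ### Charts of M and of TM, and changes of coordinates. -/

section Charts
variable {n : ℕ} {M : Type*} [TopologicalSpace M] [ChartedSpace (Coord n) M]

/-- The change of coordinates from the chart around `p` to the chart around `p'`. -/
def transition (n : ℕ) {M : Type*} [TopologicalSpace M] [ChartedSpace (Coord n) M] (p p' : M) :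
    Coord n → Coord n :=
  extChartAt (𝓡 n) p' ∘ (extChartAt (𝓡 n) p).symm

/-- The domain of `transition n p p'`. -/
def overlap (n : ℕ) {M : Type*} [TopologicalSpace M] [ChartedSpace (Coord n) M] (p p' : M) :
    Set (Coord n) :=
  (extChartAt (𝓡 n) p).target ∩ (extChartAt (𝓡 n) p).symm ⁻¹' (chartAt (Coord n) p').source

theorem isOpen_overlap (p p' : M) : IsOpen (overlap n p p') :=
  (continuousOn_extChartAt_symm p).isOpen_inter_preimage (isOpen_extChartAt_target p)
    (chartAt (Coord n) p').open_source

theorem transition_mem_overlap {p p' : M} {x : Coord n} (hx : x ∈ overlap n p p') :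
    transition n p p' x ∈ overlap n p' p := by
  have hx' := hx.2
  rw [mem_preimage, ← extChartAt_source (𝓡 n)] at hx'
  refine ⟨(extChartAt (𝓡 n) p').map_source hx', ?_⟩
  rw [mem_preimage, transition, Function.comp_apply, (extChartAt (𝓡 n) p').left_inv hx',
    ← extChartAt_source (𝓡 n)]
  exact (extChartAt (𝓡 n) p).map_target hx.1

theorem symm_transition {p p' : M} {x : Coord n} (hx : x ∈ overlap n p p') :
    (extChartAt (𝓡 n) p').symm (transition n p p' x) = (extChartAt (𝓡 n) p).symm x := by
  have hx' := hx.2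
  rw [mem_preimage, ← extChartAt_source (𝓡 n)] at hx'
  exact (extChartAt (𝓡 n) p').left_inv hx'

variable [IsManifold (𝓡 n) ∞ M]

theorem extChartAt_tangent_symm_apply (p : M) (x y : Coord n) :
    (extChartAt (𝓡 n).tangent (⟨p, 0⟩ : TangentBundle (𝓡 n) M)).symm (x, y) =
      ⟨(extChartAt (𝓡 n) p).symm x,
        tangentCoordChange (𝓡 n) p ((extChartAt (𝓡 n) p).symm x)
          ((extChartAt (𝓡 n) p).symm x) y⟩ :=
  rfl

theorem fderiv_transition {p p' : M} {x : Coord n} (hx : x ∈ overlap n p p') :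
    fderiv ℝ (transition n p p') x =
      tangentCoordChange (𝓡 n) p p' ((extChartAt (𝓡 n) p).symm x) := by
  rw [tangentCoordChange_def, (extChartAt (𝓡 n) p).right_inv hx.1]
  simp [transition]

theorem contDiffOn_transition (p p' : M) :
    ContDiffOn ℝ ∞ (transition n p p') (overlap n p p') := by
  rw [← contMDiffOn_iff_contDiffOn]
  exact (contMDiffOn_extChartAt (x := p') (n := ∞) (I := 𝓡 n)).comp
    ((contMDiffOn_extChartAt_symm p).mono inter_subset_left) (fun x hx => hx.2)

theorem fderiv_transition_comp {p p' : M} {x : Coord n} (hx : x ∈ overlap n p p') (v : Coord n) :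
    fderiv ℝ (transition n p' p) (transition n p p' x) (fderiv ℝ (transition n p p') x v) = v := by
  have hx' := hx.2
  rw [mem_preimage, ← extChartAt_source (𝓡 n)] at hx'
  rw [fderiv_transition hx, fderiv_transition (transition_mem_overlap hx), symm_transition hx]
  have hp := (extChartAt (𝓡 n) p).map_target hx.1
  rw [tangentCoordChange_comp ⟨⟨hp, hx'⟩, hp⟩, tangentCoordChange_self hp]

/-- Both sides evaluate F at the same tangent vector: the derivative of the transition is the
tangent coordinate change, and these satisfy the cocycle identity. -/
theorem localExpr_transition (F : TangentBundle (𝓡 n) M → ℝ) {p p' : M} {x : Coord n}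
    (hx : x ∈ overlap n p p') (y : Coord n) :
    localExpr F p' (transition n p p' x) (fderiv ℝ (transition n p p') x y) =
      localExpr F p x y := by
  have hx' := hx.2
  rw [mem_preimage, ← extChartAt_source (𝓡 n)] at hx'
  unfold localExpr
  rw [extChartAt_tangent_symm_apply, extChartAt_tangent_symm_apply, fderiv_transition hx,
    symm_transition hx,
    tangentCoordChange_comp ⟨⟨(extChartAt (𝓡 n) p).map_target hx.1, hx'⟩, mem_extChartAt_source _⟩]

theorem FinslerStructure.inChart_smul (F : FinslerStructure n M) (p : M) (x y : Coord n) {c : ℝ}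
    (hc : 0 < c) : F.inChart p x (c • y) = c * F.inChart p x y := by
  unfold inChart localExpr
  rw [extChartAt_tangent_symm_apply, extChartAt_tangent_symm_apply, map_smul]
  exact F.homogeneous _ _ c hc

/-- A nonzero coordinate vector represents a nonzero tangent vector because the tangent coordinate
change is invertible, so smoothness on the slit bundle applies. -/
theorem FinslerStructure.contDiffOn_inChart (F : FinslerStructure n M) (p : M) :
    ContDiffOn ℝ ∞ (fun z : Coord n × Coord n => F.inChart p z.1 z.2)
      {z | z.1 ∈ (extChartAt (𝓡 n) p).target ∧ z.2 ≠ 0} := by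
  have h := (contMDiffOn_iff.1 F.smooth).2 (⟨p, 0⟩ : TangentBundle (𝓡 n) M) 0
  simp only [extChartAt_model_space_eq_id, PartialEquiv.refl_coe, Function.id_comp,
    PartialEquiv.refl_source, preimage_univ, inter_univ] at h
  refine h.mono fun z hz => ⟨?_, ?_⟩ <;> revert z
  · rintro ⟨x, y⟩ ⟨hx, -⟩
    rw [FiberBundle.extChartAt_target]
    refine ⟨⟨hx, ?_⟩, mem_univ _⟩
    have := (extChartAt (𝓡 n) p).map_target hx
    rwa [extChartAt_source] at this
  · rintro ⟨x, y⟩ ⟨hx, hy⟩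
    simp only [mem_preimage, mem_ofPred_eq, extChartAt_tangent_symm_apply]
    intro h0
    apply hy
    have hp := (extChartAt (𝓡 n) p).map_target hx
    have h1 := tangentCoordChange_comp (I := 𝓡 n) (w := p) (x := (extChartAt (𝓡 n) p).symm x)
      (y := p) (z := (extChartAt (𝓡 n) p).symm x) (v := y) ⟨⟨hp, mem_extChartAt_source _⟩, hp⟩
    rw [tangentCoordChange_self hp] at h1
    rw [← h1]
    exact (congrArg (tangentCoordChange (𝓡 n) ((extChartAt (𝓡 n) p).symm x) p
      ((extChartAt (𝓡 n) p).symm x)) h0).trans (map_zero _)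
end Charts

/-! ### Chains built from arbitrarily short segments. -/

namespace FinslerStructure
section Chains
variable {n : ℕ} {M : Type*} [TopologicalSpace M] [ChartedSpace (Coord n) M]
  [IsManifold (𝓡 n) ∞ M] (F : FinslerStructure n M)

/-- `y` and `z` are joined by arbitrarily short geodesic segments. -/
def ShortlyJoined (y z : M) : Prop :=
  ∀ ε : ℝ, 0 < ε → ∃ (f : ℝ → M) (a b : ℝ), F.IsProjectiveMap f ∧ a ∈ Ioo (-1 : ℝ) 1 ∧
    b ∈ Ioo (-1 : ℝ) 1 ∧ f a = y ∧ f b = z ∧ poincareDist a b < ε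

theorem _root_.Finsler.poincareDist_comm (a b : ℝ) :
    poincareDist a b = poincareDist b a := by
  have h : (1 - a) * (1 + b) / ((1 - b) * (1 + a)) =
      ((1 - b) * (1 + a) / ((1 - a) * (1 + b)))⁻¹ := by rw [inv_div]
  rw [poincareDist, poincareDist, h, Real.log_inv, abs_neg]

variable {F}

theorem ShortlyJoined.symm {y z : M} (h : F.ShortlyJoined y z) : F.ShortlyJoined z y := by
  intro ε hε
  obtain ⟨f, a, b, hf, ha, hb, hy, hz, hd⟩ := h ε hε
  exact ⟨f, b, a, hf, hb, ha, hz, hy, by rwa [poincareDist_comm]⟩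

/-- The chain consisting of one segment. -/
def GeodesicChain.single {x y : M} {f : ℝ → M} {a b : ℝ} (hf : F.IsProjectiveMap f)
    (ha : a ∈ Ioo (-1 : ℝ) 1) (hb : b ∈ Ioo (-1 : ℝ) 1) (hx : f a = x) (hy : f b = y) :
    F.GeodesicChain x y where
  k := 1
  k_pos := one_pos
  pt := ![x, y]
  a := fun _ => a
  b := fun _ => b
  f := fun _ => f
  pt_zero := rfl
  pt_last := rfl
  a_mem := fun _ => ha
  b_mem := fun _ => hb
  projective := fun _ => hf
  map_a := fun i => by fin_cases i; exact hx
  map_b := fun i => by fin_cases i; exact hy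

/-- The chain obtained by adding one segment. -/
def GeodesicChain.snoc {x y z : M} (α : F.GeodesicChain x y) {f : ℝ → M} {a b : ℝ}
    (hf : F.IsProjectiveMap f) (ha : a ∈ Ioo (-1 : ℝ) 1) (hb : b ∈ Ioo (-1 : ℝ) 1)
    (hy : f a = y) (hz : f b = z) : F.GeodesicChain x z where
  k := α.k + 1
  k_pos := Nat.succ_pos _
  pt := Fin.snoc (α := fun _ => M) α.pt z
  a := Fin.snoc (α := fun _ => ℝ) α.a a
  b := Fin.snoc (α := fun _ => ℝ) α.b b
  f := Fin.snoc (α := fun _ => ℝ → M) α.f f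
  pt_zero := by
    have := Fin.snoc_castSucc (α := fun _ => M) z α.pt 0
    rw [Fin.castSucc_zero] at this
    rw [this, α.pt_zero]
  pt_last := by simp
  a_mem := fun i => by
    refine Fin.lastCases ?_ (fun i => ?_) i
    · simpa using ha
    · simpa using α.a_mem i
  b_mem := fun i => by
    refine Fin.lastCases ?_ (fun i => ?_) i
    · simpa using hb
    · simpa using α.b_mem i
  projective := fun i => by
    refine Fin.lastCases ?_ (fun i => ?_) i
    · simpa using hf
    · simpa using α.projective i
  map_a := fun i => by
    refine Fin.lastCases ?_ (fun i => ?_) i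
    · simpa [α.pt_last] using hy
    · simpa using α.map_a i
  map_b := fun i => by
    refine Fin.lastCases ?_ (fun i => ?_) i
    · simpa using hz
    · rw [Fin.snoc_castSucc, Fin.snoc_castSucc, α.map_b, Fin.succ_castSucc, Fin.snoc_castSucc]

theorem GeodesicChain.length_single {x y : M} {f : ℝ → M} {a b : ℝ} (hf : F.IsProjectiveMap f)
    (ha : a ∈ Ioo (-1 : ℝ) 1) (hb : b ∈ Ioo (-1 : ℝ) 1) (hx : f a = x) (hy : f b = y) :
    (GeodesicChain.single hf ha hb hx hy).length = poincareDist a b := by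
  unfold GeodesicChain.length GeodesicChain.single
  exact Fin.sum_univ_one _

theorem GeodesicChain.length_snoc {x y z : M} (α : F.GeodesicChain x y) {f : ℝ → M} {a b : ℝ}
    (hf : F.IsProjectiveMap f) (ha : a ∈ Ioo (-1 : ℝ) 1) (hb : b ∈ Ioo (-1 : ℝ) 1)
    (hy : f a = y) (hz : f b = z) :
    (α.snoc hf ha hb hy hz).length = α.length + poincareDist a b := by
  unfold GeodesicChain.length GeodesicChain.snoc
  refine (Fin.sum_univ_castSucc _).trans ?_
  simp

/-- The old chain and the new segment each receive half of ε. The transitive, not reflexive, closure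
is the right one, since a chain has at least one segment. -/
theorem exists_chain_of_transGen {x y : M} (h : Relation.TransGen F.ShortlyJoined x y) :
    ∀ ε : ℝ, 0 < ε → ∃ α : F.GeodesicChain x y, α.length < ε := by
  induction h with
  | single h =>
    intro ε hε
    obtain ⟨f, a, b, hf, ha, hb, hy, hz, hd⟩ := h ε hε
    exact ⟨.single hf ha hb hy hz, by rwa [GeodesicChain.length_single]⟩
  | tail _ h ih =>
    intro ε hε
    obtain ⟨α, hα⟩ := ih (ε / 2) (half_pos hε)
    obtain ⟨f, a, b, hf, ha, hb, hy, hz, hd⟩ := h (ε / 2) (half_pos hε)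
    exact ⟨α.snoc hf ha hb hy hz, by rw [GeodesicChain.length_snoc]; linarith⟩

/-- With values in [0, ∞] and an empty infimum equal to ∞, the value 0 also records that chains
exist. -/
theorem pseudoDist_eq_zero_of_transGen {x y : M}
    (h : Relation.TransGen F.ShortlyJoined x y) : F.pseudoDist x y = 0 := by
  refine le_antisymm (ENNReal.le_of_forall_pos_le_add fun ε hε _ => ?_) zero_le
  obtain ⟨α, hα⟩ := exists_chain_of_transGen h ε (by exact_mod_cast hε)
  refine (iInf_le _ α).trans ?_
  rw [zero_add]
  exact (ENNReal.ofReal_le_ofReal hα.le).trans (by simp)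

end Chains
end FinslerStructure

/-! ### Projective parameters from the linear equation u'' = -Qu. -/

section Parameter

/-- The clamped equation `u'' = -Q max(u, 0)`, as a first order system for `(u, u')`. -/
theorem exists_solution_clamped {Q : ℝ → ℝ} (hQ : Continuous Q) (hQ0 : ∀ t, 0 ≤ Q t) (a : ℝ)
    {T : ℝ} (hT : 1 ≤ T) :
    ∃ (u w : ℝ → ℝ) (K : ℝ), u a = 1 ∧ w a = 0 ∧ 0 < K ∧
      ∀ t ∈ Ioo (a - T) (a + T), HasDerivAt u (w t) t ∧
        HasDerivAt w (-Q t * max 0 (u t)) t ∧ |w t| ≤ K ∧ u t ≤ 1 := by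
  obtain ⟨C₀, hC₀⟩ := (isCompact_Icc (a := a - T) (b := a + T)).bddAbove_image hQ.continuousOn
  set C : ℝ := max C₀ 1 with hC
  have hC1 : 1 ≤ C := le_max_right _ _
  have hCQ : ∀ t ∈ Icc (a - T) (a + T), Q t ≤ C := fun t ht =>
    (hC₀ (mem_image_of_mem _ ht)).trans (le_max_left _ _)
  set L : ℝ := C * T with hL
  have hL1 : 1 ≤ L := one_le_mul_of_one_le_of_one_le hC1 hT
  have hCL : C ≤ L := le_mul_of_one_le_right (by linarith) hT
  -- Clamping the velocity to [-L, L] and u to [0, 1] makes the field bounded and Lipschitz, so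
  -- Picard-Lindelöf covers the whole interval at once. The clamps at ±L and 1 turn out to be
  -- inactive; only the one at 0 survives.
  set f : ℝ → ℝ × ℝ → ℝ × ℝ := fun t z =>
    (max (-L) (min L z.2), -Q t * max 0 (min 1 z.1)) with hf
  have ha : a ∈ Icc (a - T) (a + T) := ⟨by linarith, by linarith⟩
  have hPL : IsPicardLindelof f (tmin := a - T) (tmax := a + T) ⟨a, ha⟩ ((1 : ℝ), (0 : ℝ))
      (L * T).toNNReal 0 L.toNNReal C.toNNReal := by
    refine ⟨fun t ht => ?_, fun x _ => ?_, fun t ht x _ => ?_, ?_⟩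
    · refine LipschitzWith.lipschitzOnWith (LipschitzWith.of_dist_le_mul fun x y => ?_)
      rw [Real.coe_toNNReal _ (by linarith)]
      simp only [hf, Prod.dist_eq, Real.dist_eq]
      have hm : 0 ≤ max |x.1 - y.1| |x.2 - y.2| := le_max_of_le_left (abs_nonneg _)
      refine max_le ?_ ?_
      · calc |max (-L) (min L x.2) - max (-L) (min L y.2)| ≤ |min L x.2 - min L y.2| :=
              abs_max_sub_max_le_max _ _ _ _ |>.trans (by simp)
          _ ≤ |x.2 - y.2| := abs_min_sub_min_le_max _ _ _ _ |>.trans (by simp)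
          _ ≤ max |x.1 - y.1| |x.2 - y.2| := le_max_right _ _
          _ ≤ C * max |x.1 - y.1| |x.2 - y.2| := le_mul_of_one_le_left hm hC1
      · rw [← mul_sub, abs_mul, abs_neg, abs_of_nonneg (hQ0 t)]
        refine mul_le_mul (hCQ t ht) ?_ (abs_nonneg _) (by linarith)
        calc |max 0 (min 1 x.1) - max 0 (min 1 y.1)| ≤ |min 1 x.1 - min 1 y.1| :=
              abs_max_sub_max_le_max _ _ _ _ |>.trans (by simp)
          _ ≤ |x.1 - y.1| := abs_min_sub_min_le_max _ _ _ _ |>.trans (by simp)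
          _ ≤ _ := le_max_left _ _
    · exact Continuous.continuousOn (by simp only [hf]; fun_prop)
    · rw [Real.coe_toNNReal _ (by linarith), Prod.norm_def]
      refine max_le ?_ ?_
      · rw [Real.norm_eq_abs, abs_le]
        exact ⟨le_max_left _ _, max_le (by linarith) (min_le_left _ _)⟩
      · simp only [hf, Real.norm_eq_abs, abs_mul, abs_neg, abs_of_nonneg (hQ0 t)]
        have h1 : |max 0 (min 1 x.1)| ≤ 1 := by
          rw [abs_of_nonneg (le_max_left _ _)]
          exact max_le zero_le_one (min_le_left _ _)
        calc Q t * |max 0 (min 1 x.1)| ≤ C * 1 :=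
              mul_le_mul (hCQ t ht) h1 (abs_nonneg _) (by linarith)
          _ ≤ L := by linarith
    · rw [Real.coe_toNNReal _ (by linarith), Real.coe_toNNReal _ (by positivity)]
      simp
  obtain ⟨α, hα0, hα⟩ := hPL.exists_eq_forall_mem_Icc_hasDerivWithinAt₀
  dsimp only at hα0
  have hu : ∀ t ∈ Icc (a - T) (a + T), HasDerivWithinAt (fun s => (α s).1)
      (max (-L) (min L (α t).2)) (Icc (a - T) (a + T)) t := fun t ht => by
    exact hasFDerivAt_fst.comp_hasDerivWithinAt t (hα t ht)
  have hw : ∀ t ∈ Icc (a - T) (a + T), HasDerivWithinAt (fun s => (α s).2)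
      (-Q t * max 0 (min 1 (α t).1)) (Icc (a - T) (a + T)) t := fun t ht => by
    exact hasFDerivAt_snd.comp_hasDerivWithinAt t (hα t ht)
  have hu0 : (α a).1 = 1 := by rw [hα0]
  have hw0 : (α a).2 = 0 := by rw [hα0]
  have hwL : ∀ t ∈ Icc (a - T) (a + T), |(α t).2| ≤ L := by
    intro t ht
    have h := Convex.norm_image_sub_le_of_norm_hasDerivWithin_le (C := C) hw (fun s hs => ?_)
      (convex_Icc _ _) ha ht
    · rw [hw0, sub_zero, Real.norm_eq_abs, Real.norm_eq_abs] at h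
      refine h.trans ?_
      have : |t - a| ≤ T := abs_le.2 ⟨by linarith [ht.1], by linarith [ht.2]⟩
      exact mul_le_mul_of_nonneg_left this (by linarith)
    · have h1 : |max 0 (min 1 (α s).1)| ≤ 1 := by
        rw [abs_of_nonneg (le_max_left _ _)]
        exact max_le zero_le_one (min_le_left _ _)
      rw [Real.norm_eq_abs, abs_mul, abs_neg, abs_of_nonneg (hQ0 s)]
      calc Q s * |max 0 (min 1 (α s).1)| ≤ C * 1 :=
            mul_le_mul (hCQ s hs) h1 (abs_nonneg _) (by linarith)
        _ = C := mul_one _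
  have hu' : ∀ t ∈ Icc (a - T) (a + T), HasDerivWithinAt (fun s => (α s).1)
      (α t).2 (Icc (a - T) (a + T)) t := fun t ht => by
    have := hu t ht
    have h1 := abs_le.1 (hwL t ht)
    rwa [min_eq_right h1.2, max_eq_right h1.1] at this
  -- Since Q ≥ 0 and u is clamped at 0, w is decreasing whatever the sign of u. With w(a) = 0 this
  -- makes a a maximum of u.
  have hwanti : AntitoneOn (fun s => (α s).2) (Icc (a - T) (a + T)) := by
    refine antitoneOn_of_hasDerivWithinAt_nonpos (convex_Icc _ _)
      (fun t ht => (hw t ht).continuousWithinAt)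
      (fun t ht => (hw t (interior_subset ht)).mono interior_subset) (fun t _ => ?_)
    have := mul_nonneg (hQ0 t) (le_max_left 0 (min 1 (α t).1))
    linarith
  have hu1 : ∀ t ∈ Icc (a - T) (a + T), (α t).1 ≤ 1 := by
    intro t ht
    rw [← hu0]
    rcases le_total a t with h | h
    · have hsub : Icc a t ⊆ Icc (a - T) (a + T) := Icc_subset_Icc ha.1 ht.2
      refine antitoneOn_of_hasDerivWithinAt_nonpos (f := fun s => (α s).1) (convex_Icc a t)
        (fun s hs => ((hu' s (hsub hs)).mono hsub).continuousWithinAt)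
        (fun s hs => (hu' s (hsub (interior_subset hs))).mono (interior_subset.trans hsub))
        (fun s hs => ?_) (left_mem_Icc.2 h) (right_mem_Icc.2 h) h
      have hs := interior_subset hs
      exact (hwanti ha (hsub hs) hs.1).trans hw0.le
    · have hsub : Icc t a ⊆ Icc (a - T) (a + T) := Icc_subset_Icc ht.1 ha.2
      refine monotoneOn_of_hasDerivWithinAt_nonneg (f := fun s => (α s).1) (convex_Icc t a)
        (fun s hs => ((hu' s (hsub hs)).mono hsub).continuousWithinAt)
        (fun s hs => (hu' s (hsub (interior_subset hs))).mono (interior_subset.trans hsub))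
        (fun s hs => ?_) (left_mem_Icc.2 h) (right_mem_Icc.2 h) h
      have hs := interior_subset hs
      exact hw0.ge.trans (hwanti (hsub hs) ha hs.2)
  refine ⟨fun s => (α s).1, fun s => (α s).2, L, hu0, hw0, by linarith, fun t ht => ?_⟩
  have ht' := Ioo_subset_Icc_self ht
  have hn : Icc (a - T) (a + T) ∈ 𝓝 t := Icc_mem_nhds ht.1 ht.2
  refine ⟨(hu' t ht').hasDerivAt hn, ?_, hwL t ht', hu1 t ht'⟩
  have := (hw t ht').hasDerivAt hn
  rwa [min_eq_right (hu1 t ht')] at this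

/-- The integral of `1 / u²` becomes large before `u` vanishes. -/
theorem exists_le_integral_inv_sq {u w : ℝ → ℝ} {a R K : ℝ} (hK : 0 < K) (hR : 0 < R)
    (ha : u a = 1)
    (hu : ∀ t ∈ Ico a (a + (R + 1)), HasDerivAt u (w t) t ∧ |w t| ≤ K ∧ u t ≤ 1) :
    ∃ t ∈ Ioo a (a + (R + 1)), (∀ s ∈ Icc a t, 0 < u s) ∧ R ≤ ∫ s in a..t, (u s ^ 2)⁻¹ := by
  have hcont : ContinuousOn u (Ico a (a + (R + 1))) := fun t ht =>
    (hu t ht).1.continuousAt.continuousWithinAt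
  by_cases hz : ∃ t ∈ Icc a (a + R), u t ≤ 0
  · have hsub : Icc a (a + R) ⊆ Ico a (a + (R + 1)) := fun t ht => ⟨ht.1, by linarith [ht.2]⟩
    set Z := Icc a (a + R) ∩ u ⁻¹' Iic 0 with hZ
    have hZc : IsClosed Z := (hcont.mono hsub).preimage_isClosed_of_isClosed isClosed_Icc isClosed_Iic
    have hZne : Z.Nonempty := by obtain ⟨t, ht, h⟩ := hz; exact ⟨t, ht, h⟩
    have hZb : BddBelow Z := ⟨a, fun t ht => ht.1.1⟩
    set β := sInf Z with hβ
    have hβZ : β ∈ Z := hZc.csInf_mem hZne hZb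
    have hpos : ∀ t ∈ Ico a β, 0 < u t := by
      intro t ht
      by_contra h
      exact absurd (csInf_le hZb ⟨⟨ht.1, ht.2.le.trans hβZ.1.2⟩, not_lt.1 h⟩) (not_le.2 ht.2)
    have haβ : a < β := lt_of_le_of_ne hβZ.1.1 fun h => by
      have := hβZ.2
      rw [← h, mem_preimage, ha, mem_Iic] at this
      linarith
    have hle : ∀ t ∈ Ico a β, u t ≤ K * (β - t) := by
      intro t ht
      have h := Convex.norm_image_sub_le_of_norm_hasDerivWithin_le (f := u) (f' := w) (C := K)
        (s := Icc a (a + R)) (fun s hs => (hu s (hsub hs)).1.hasDerivWithinAt)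
        (fun s hs => (hu s (hsub hs)).2.1) (convex_Icc _ _) hβZ.1 ⟨ht.1, ht.2.le.trans hβZ.1.2⟩
      rw [Real.norm_eq_abs, Real.norm_eq_abs, abs_sub_comm t, abs_of_pos (sub_pos.2 ht.2)] at h
      have h2 : u β ≤ 0 := hβZ.2
      linarith [le_abs_self (u t - u β)]
    -- β is the first zero of u, and u ≤ K(β - t) before it. The lower bound K⁻²(β - s)⁻² of u⁻²
    -- integrates to K⁻²(1/e - 1/(β - a)) over [a, β - e]; this e makes it exactly R.
    set e := (K ^ 2 * R + (β - a)⁻¹)⁻¹ with he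
    have hba : 0 < β - a := sub_pos.2 haβ
    have hinv : (β - a)⁻¹ < K ^ 2 * R + (β - a)⁻¹ := by
      have : 0 < K ^ 2 * R := by positivity
      linarith
    have he0 : 0 < e := by positivity
    have hea : e < β - a := by
      rw [he]
      exact inv_lt_of_inv_lt₀ hba hinv
    have htβ : β - e ∈ Ioo a β := ⟨by linarith, by linarith⟩
    have hsub2 : ∀ s ∈ Icc a (β - e), s ∈ Ico a β := fun s hs => ⟨hs.1, by linarith [hs.2]⟩
    refine ⟨β - e, ⟨htβ.1, by linarith [hβZ.1.2]⟩, fun s hs => hpos s (hsub2 s hs), ?_⟩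
    have h1 : ∫ s in a..(β - e), K⁻¹ ^ 2 * ((β - s) ^ 2)⁻¹ = R := by
      have hd : ∀ s ∈ uIcc a (β - e), HasDerivAt (fun s => K⁻¹ ^ 2 * (β - s)⁻¹)
          (K⁻¹ ^ 2 * ((β - s) ^ 2)⁻¹) s := by
        intro s hs
        rw [uIcc_of_le htβ.1.le] at hs
        have hne : β - s ≠ 0 := (sub_pos.2 (hsub2 s hs).2).ne'
        have := (((hasDerivAt_id s).const_sub β).inv hne).const_mul (K⁻¹ ^ 2)
        simpa using this
      rw [intervalIntegral.integral_eq_sub_of_hasDerivAt hd]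
      · rw [sub_sub_cancel, he, inv_inv]
        field_simp
        ring
      · refine ContinuousOn.intervalIntegrable fun s hs => ?_
        rw [uIcc_of_le htβ.1.le] at hs
        have hne : (β - s) ^ 2 ≠ 0 := pow_ne_zero _ (sub_pos.2 (hsub2 s hs).2).ne'
        exact ContinuousAt.continuousWithinAt (by fun_prop (disch := assumption))
    rw [← h1]
    refine intervalIntegral.integral_mono_on htβ.1.le ?_ ?_ fun s hs => ?_
    · refine ContinuousOn.intervalIntegrable fun s hs => ?_
      rw [uIcc_of_le htβ.1.le] at hs
      have hne : (β - s) ^ 2 ≠ 0 := pow_ne_zero _ (sub_pos.2 (hsub2 s hs).2).ne'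
      exact ContinuousAt.continuousWithinAt (by fun_prop (disch := assumption))
    · refine ContinuousOn.intervalIntegrable ?_
      rw [uIcc_of_le htβ.1.le]
      have hcu : ContinuousOn u (Icc a (β - e)) := hcont.mono fun s hs =>
        ⟨hs.1, by linarith [hs.2, hβZ.1.2]⟩
      exact (hcu.pow 2).inv₀ fun s hs => pow_ne_zero _ (hpos s (hsub2 s hs)).ne'
    · rw [inv_pow, ← mul_inv, ← mul_pow]
      have h0 := hpos s (hsub2 s hs)
      exact inv_anti₀ (by positivity) (pow_le_pow_left₀ h0.le (hle s (hsub2 s hs)) 2)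
  · push Not at hz
    refine ⟨a + R, ⟨by linarith, by linarith⟩, hz, ?_⟩
    have hle : a ≤ a + R := by linarith
    have h1 : ∫ _ in a..(a + R), (1 : ℝ) = R := by simp
    conv_lhs => rw [← h1]
    refine intervalIntegral.integral_mono_on hle (by simp) ?_ fun s hs => ?_
    · refine ContinuousOn.intervalIntegrable ?_
      rw [uIcc_of_le hle]
      exact ((hcont.mono fun s hs => ⟨hs.1, by linarith [hs.2]⟩).pow 2).inv₀
        fun s hs => pow_ne_zero _ (hz s hs).ne'
    · have h0 := hz s hs
      have h2 := (hu s ⟨hs.1, by linarith [hs.2]⟩).2.2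
      exact (one_le_inv₀ (by positivity)).2 (pow_le_one₀ h0.le h2)

/-- From π' = u⁻²/R follows π''/π' = -2u'/u, hence {π, s} = (π''/π')' - ½(π''/π')² = -2u''/u = 2Q.
The factor R drops out. -/
theorem schwarzian_eq {π u w : ℝ → ℝ} {J : Set ℝ} {Q : ℝ → ℝ} {R : ℝ} (hJ : IsOpen J) (hR : R ≠ 0)
    (hpos : ∀ t ∈ J, u t ≠ 0) (hπ : ∀ t ∈ J, HasDerivAt π ((u t ^ 2)⁻¹ / R) t)
    (hu : ∀ t ∈ J, HasDerivAt u (w t) t) (hw : ∀ t ∈ J, HasDerivAt w (-Q t * u t) t)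
    {s : ℝ} (hs : s ∈ J) : schwarzian π s = 2 * Q s := by
  have h1 : ∀ t ∈ J, deriv π t = (u t ^ 2)⁻¹ / R := fun t ht => (hπ t ht).deriv
  have h2 : ∀ t ∈ J, HasDerivAt (deriv π) (-2 * w t / u t ^ 3 / R) t := fun t ht => by
    refine HasDerivAt.congr_of_eventuallyEq ?_
      (Filter.eventuallyEq_of_mem (hJ.mem_nhds ht) h1)
    have h0 := hpos t ht
    refine ((((hu t ht).pow 2).inv (pow_ne_zero 2 h0)).div_const R).congr_deriv ?_
    simp only [Nat.cast_ofNat, Pi.pow_apply, Nat.reduceSub, pow_one]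
    field_simp
  have h3 : ∀ t ∈ J, HasDerivAt (deriv (deriv π))
      ((2 * Q t / u t ^ 2 + 6 * w t ^ 2 / u t ^ 4) / R) t := fun t ht => by
    refine HasDerivAt.congr_of_eventuallyEq ?_
      (Filter.eventuallyEq_of_mem (hJ.mem_nhds ht) fun x hx => (h2 x hx).deriv)
    have h0 := hpos t ht
    refine ((((hw t ht).const_mul (-2)).div ((hu t ht).pow 3)
      (pow_ne_zero 3 h0)).div_const R).congr_deriv ?_
    simp only [Nat.cast_ofNat, Pi.pow_apply, Nat.reduceSub]
    field_simp
    ring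
  have h0 := hpos s hs
  rw [schwarzian, iteratedDeriv_succ, iteratedDeriv_succ, iteratedDeriv_one, (h3 s hs).deriv,
    (h2 s hs).deriv, h1 s hs]
  field_simp
  ring

/-- Continuity of Q suffices: w is C¹, so u is C², so π' is C². -/
theorem contDiffOn_three {π u w : ℝ → ℝ} {J : Set ℝ} {Q : ℝ → ℝ} {R : ℝ} (hJ : IsOpen J)
    (hQ : Continuous Q)
    (hpos : ∀ t ∈ J, u t ≠ 0) (hπ : ∀ t ∈ J, HasDerivAt π ((u t ^ 2)⁻¹ / R) t)
    (hu : ∀ t ∈ J, HasDerivAt u (w t) t) (hw : ∀ t ∈ J, HasDerivAt w (-Q t * u t) t) :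
    ContDiffOn ℝ 3 π J := by
  have hu0 : ContinuousOn u J := fun t ht => (hu t ht).continuousAt.continuousWithinAt
  have hw1 : ContDiffOn ℝ 1 w J := by
    rw [show (1 : WithTop ℕ∞) = 0 + 1 by rfl, contDiffOn_succ_iff_deriv_of_isOpen hJ]
    refine ⟨fun t ht => (hw t ht).differentiableAt.differentiableWithinAt, by simp, ?_⟩
    exact (contDiffOn_zero.2 (hQ.neg.continuousOn.mul hu0)).congr fun t ht => (hw t ht).deriv
  have hu2 : ContDiffOn ℝ 2 u J := by
    rw [show (2 : WithTop ℕ∞) = 1 + 1 by rfl, contDiffOn_succ_iff_deriv_of_isOpen hJ]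
    exact ⟨fun t ht => (hu t ht).differentiableAt.differentiableWithinAt, by simp,
      hw1.congr fun t ht => (hu t ht).deriv⟩
  rw [show (3 : WithTop ℕ∞) = 2 + 1 by rfl, contDiffOn_succ_iff_deriv_of_isOpen hJ]
  refine ⟨fun t ht => (hπ t ht).differentiableAt.differentiableWithinAt, by simp, ?_⟩
  exact (((hu2.pow 2).inv fun t ht => pow_ne_zero 2 (hpos t ht)).div_const R).congr
    fun t ht => (hπ t ht).deriv

/-- Solutions of `{π, s} = 2 Q` that map an interval onto `(-1, 1)` and that are small near `a`. -/
theorem exists_schwarzian_eq {Q : ℝ → ℝ} (hQ : Continuous Q) (hQ0 : ∀ t, 0 ≤ Q t) (a : ℝ) :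
    ∃ δ > 0, ∀ R : ℝ, 1 < R → ∃ (J : Set ℝ) (π : ℝ → ℝ), IsOpen J ∧ J.OrdConnected ∧
      ContDiffOn ℝ 3 π J ∧ (∀ s ∈ J, deriv π s ≠ 0) ∧ (∀ s ∈ J, schwarzian π s = 2 * Q s) ∧
      BijOn π J (Ioo (-1) 1) ∧ π a = 0 ∧ ∀ b, |b - a| ≤ δ → b ∈ J ∧ |π b| ≤ 1 / R := by
  obtain ⟨C₀, hC₀⟩ := (isCompact_Icc (a := a - 1) (b := a + 1)).bddAbove_image hQ.continuousOn
  set C : ℝ := max C₀ 1 with hC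
  have hC1 : 1 ≤ C := le_max_right _ _
  have hCQ : ∀ t ∈ Icc (a - 1) (a + 1), Q t ≤ C := fun t ht =>
    (hC₀ (mem_image_of_mem _ ht)).trans (le_max_left _ _)
  -- Chosen before R. On [a - δ, a + δ] it forces |w| ≤ Cδ = 1/4, hence u ≥ 1/2 and u⁻² ≤ 4, so the
  -- integral of u⁻² from a is at most 4δ ≤ 1 in absolute value.
  set δ : ℝ := (4 * C)⁻¹ with hδ
  have hδ0 : 0 < δ := by positivity
  have hCδ : C * δ = 1 / 4 := by rw [hδ]; field_simp
  have hδ4 : δ ≤ 1 / 4 := hCδ ▸ le_mul_of_one_le_left hδ0.le hC1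
  refine ⟨δ, hδ0, fun R hR => ?_⟩
  obtain ⟨u, w, K, hua, hwa, hK, hsol⟩ :=
    exists_solution_clamped hQ hQ0 a (T := R + 1) (by linarith)
  have haΩ : a ∈ Ioo (a - (R + 1)) (a + (R + 1)) := ⟨by linarith, by linarith⟩
  have hucont : ContinuousOn u (Ioo (a - (R + 1)) (a + (R + 1))) := fun t ht =>
    (hsol t ht).1.continuousAt.continuousWithinAt
  obtain ⟨t₁, ht₁, hpos₁, hP₁⟩ := exists_le_integral_inv_sq hK (by linarith : 0 < R) hua
    fun t ht => ⟨(hsol t ⟨by linarith [ht.1], ht.2⟩).1, (hsol t ⟨by linarith [ht.1], ht.2⟩).2.2⟩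
  -- The left side of a is the right side after the reflection t ↦ 2a - t.
  obtain ⟨t₂, ht₂, hpos₂, hP₂⟩ := exists_le_integral_inv_sq (u := fun t => u (2 * a - t))
    (w := fun t => -w (2 * a - t)) (a := a) hK (by linarith : 0 < R)
    (by simpa [two_mul] using hua) fun t ht => by
      have h := hsol (2 * a - t) ⟨by linarith [ht.2], by linarith [ht.1]⟩
      refine ⟨?_, by simpa using h.2.2.1, h.2.2.2⟩
      have := h.1.comp t ((hasDerivAt_id t).const_sub (2 * a))
      simpa [Function.comp_def] using this
  rw [intervalIntegral.integral_comp_sub_left (fun s => (u s ^ 2)⁻¹),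
    show 2 * a - a = a by ring] at hP₂
  set t₀ := 2 * a - t₂ with ht₀
  have hpos : ∀ s ∈ Icc t₀ t₁, 0 < u s := by
    intro s hs
    rcases le_total a s with h | h
    · exact hpos₁ s ⟨h, hs.2⟩
    · simpa using hpos₂ (2 * a - s) ⟨by linarith, by linarith [hs.1]⟩
  have ht₀a : t₀ < a := by linarith [ht₂.1]
  have ht₀₁ : t₀ < t₁ := ht₀a.trans ht₁.1
  have hsubΩ : Icc t₀ t₁ ⊆ Ioo (a - (R + 1)) (a + (R + 1)) := fun s hs =>
    ⟨by linarith [hs.1, ht₂.2], hs.2.trans_lt ht₁.2⟩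
  have hac : a ∈ Icc t₀ t₁ := ⟨ht₀a.le, ht₁.1.le⟩
  have hinv : ContinuousOn (fun s => (u s ^ 2)⁻¹) (Icc t₀ t₁) :=
    ((hucont.mono hsubΩ).pow 2).inv₀ fun s hs => pow_ne_zero _ (hpos s hs).ne'
  set P : ℝ → ℝ := fun t => ∫ s in a..t, (u s ^ 2)⁻¹ with hP
  have hint : ∀ s ∈ Icc t₀ t₁, ∀ t ∈ Icc t₀ t₁,
      IntervalIntegrable (fun s => (u s ^ 2)⁻¹) MeasureTheory.volume s t := fun s hs t ht =>
    (hinv.mono (ordConnected_Icc.uIcc_subset hs ht)).intervalIntegrable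
  have hPd : ∀ t ∈ Ioo t₀ t₁, HasDerivAt P (u t ^ 2)⁻¹ t := fun t ht =>
    intervalIntegral.integral_hasDerivAt_right (hint a hac t (Ioo_subset_Icc_self ht))
      (ContinuousOn.stronglyMeasurableAtFilter isOpen_Ioo (hinv.mono Ioo_subset_Icc_self) t ht)
      (hinv.continuousAt (Icc_mem_nhds ht.1 ht.2))
  have hPc : ContinuousOn P (Icc t₀ t₁) := by
    have := intervalIntegral.continuousOn_primitive_interval' (a := a)
      (hint t₀ (left_mem_Icc.2 ht₀₁.le) t₁ (right_mem_Icc.2 ht₀₁.le))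
      (by rwa [uIcc_of_le ht₀₁.le])
    rwa [uIcc_of_le ht₀₁.le] at this
  have hPm : StrictMonoOn P (Icc t₀ t₁) := by
    refine strictMonoOn_of_deriv_pos (convex_Icc _ _) hPc fun t ht => ?_
    rw [interior_Icc] at ht
    rw [(hPd t ht).deriv]
    have := hpos t (Ioo_subset_Icc_self ht)
    positivity
  have hPa : P a = 0 := by simp [hP]
  have hPt₀ : P t₀ ≤ -R := by
    simp only [hP]
    rw [intervalIntegral.integral_symm]
    linarith
  -- The ends of J are where P takes the values -R and R, so that P/R maps J onto (-1, 1).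
  obtain ⟨l, hl, hPl⟩ := intermediate_value_Icc ht₀a.le
    (hPc.mono (Icc_subset_Icc_right ht₁.1.le)) (show -R ∈ Icc (P t₀) (P a) from
      ⟨hPt₀, by rw [hPa]; linarith⟩)
  obtain ⟨r, hr, hPr⟩ := intermediate_value_Icc ht₁.1.le
    (hPc.mono (Icc_subset_Icc_left ht₀a.le)) (show R ∈ Icc (P a) (P t₁) from
      ⟨by rw [hPa]; linarith, hP₁⟩)
  have hl' : l ∈ Icc t₀ t₁ := ⟨hl.1, hl.2.trans ht₁.1.le⟩
  have hr' : r ∈ Icc t₀ t₁ := ⟨ht₀a.le.trans hr.1, hr.2⟩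
  have hJsub : Ioo l r ⊆ Ioo t₀ t₁ := Ioo_subset_Ioo hl.1 hr.2
  have hlr : l ≤ r := hl.2.trans hr.1
  have hR0 : R ≠ 0 := by linarith
  have hpos' : ∀ t ∈ Ioo l r, u t ≠ 0 := fun t ht =>
    (hpos t (Ioo_subset_Icc_self (hJsub ht))).ne'
  have hπd : ∀ t ∈ Ioo l r, HasDerivAt (fun t => P t / R) ((u t ^ 2)⁻¹ / R) t := fun t ht =>
    (hPd t (hJsub ht)).div_const R
  have hΩ : ∀ t ∈ Ioo l r, t ∈ Ioo (a - (R + 1)) (a + (R + 1)) := fun t ht =>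
    hsubΩ (Ioo_subset_Icc_self (hJsub ht))
  have hud : ∀ t ∈ Ioo l r, HasDerivAt u (w t) t := fun t ht => (hsol t (hΩ t ht)).1
  have hwd : ∀ t ∈ Ioo l r, HasDerivAt w (-Q t * u t) t := fun t ht => by
    have := (hsol t (hΩ t ht)).2.1
    rwa [max_eq_right (hpos t (Ioo_subset_Icc_self (hJsub ht))).le] at this
  refine ⟨Ioo l r, fun t => P t / R, isOpen_Ioo, ordConnected_Ioo,
    contDiffOn_three isOpen_Ioo hQ hpos' hπd hud hwd, fun s hs => ?_,
    fun s hs => schwarzian_eq isOpen_Ioo hR0 hpos' hπd hud hwd hs, ⟨?_, ?_, ?_⟩, by simp [hPa], ?_⟩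
  · rw [(hπd s hs).deriv]
    exact div_ne_zero (inv_ne_zero (pow_ne_zero 2 (hpos' s hs))) hR0
  · intro t ht
    have ht' := Ioo_subset_Icc_self (hJsub ht)
    have h1 := hPm hl' ht' ht.1
    have h2 := hPm ht' hr' ht.2
    rw [hPl] at h1
    rw [hPr] at h2
    have hRp : 0 < R := by linarith
    exact ⟨by rw [lt_div_iff₀ hRp]; linarith, by rw [div_lt_iff₀ hRp]; linarith⟩
  · intro s hs t ht hst
    refine hPm.injOn (Ioo_subset_Icc_self (hJsub hs)) (Ioo_subset_Icc_self (hJsub ht)) ?_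
    field_simp at hst
    exact hst
  · intro c hc
    have hRp : 0 < R := by linarith
    obtain ⟨t, ht, hPt⟩ := intermediate_value_Ioo hlr (hPc.mono (Icc_subset_Icc hl.1 hr.2))
      (show c * R ∈ Ioo (P l) (P r) from by
        rw [hPl, hPr]
        constructor <;> nlinarith [hc.1, hc.2])
    exact ⟨t, ht, by simp only [hPt]; field_simp⟩
  · have hδΩ : ∀ t, |t - a| ≤ δ → t ∈ Ioo (a - (R + 1)) (a + (R + 1)) := fun t ht => by
      have := abs_le.1 ht
      exact ⟨by linarith, by linarith⟩
    have hball : ∀ t, |t - a| ≤ δ ↔ t ∈ Icc (a - δ) (a + δ) := fun t => by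
      rw [abs_le, mem_Icc]
      constructor <;> rintro ⟨h1, h2⟩ <;> constructor <;> linarith
    have haδ : a ∈ Icc (a - δ) (a + δ) := ⟨by linarith, by linarith⟩
    have hwδ : ∀ t ∈ Icc (a - δ) (a + δ), |w t| ≤ 1 / 4 := by
      intro t ht
      have h := Convex.norm_image_sub_le_of_norm_hasDerivWithin_le (C := C) (f := w)
        (fun s hs => (hsol s (hδΩ s ((hball s).2 hs))).2.1.hasDerivWithinAt) (fun s hs => ?_)
        (convex_Icc _ _) haδ ht
      · rw [hwa, sub_zero, Real.norm_eq_abs, Real.norm_eq_abs] at h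
        exact h.trans (hCδ ▸ mul_le_mul_of_nonneg_left ((hball t).2 ht) (by linarith))
      · have h1 : |max 0 (u s)| ≤ 1 := by
          rw [abs_of_nonneg (le_max_left _ _)]
          exact max_le zero_le_one (hsol s (hδΩ s ((hball s).2 hs))).2.2.2
        rw [Real.norm_eq_abs, abs_mul, abs_neg, abs_of_nonneg (hQ0 s)]
        calc Q s * |max 0 (u s)| ≤ C * 1 :=
              mul_le_mul (hCQ s ⟨by linarith [hs.1], by linarith [hs.2]⟩) h1 (abs_nonneg _)
                (by linarith)
          _ = C := mul_one _
    have huδ : ∀ t ∈ Icc (a - δ) (a + δ), 1 / 2 ≤ u t := by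
      intro t ht
      have h := Convex.norm_image_sub_le_of_norm_hasDerivWithin_le (C := 1 / 4) (f := u)
        (fun s hs => (hsol s (hδΩ s ((hball s).2 hs))).1.hasDerivWithinAt) hwδ
        (convex_Icc _ _) haδ ht
      rw [hua, Real.norm_eq_abs, Real.norm_eq_abs] at h
      have h1 := (hball t).2 ht
      have h2 := neg_abs_le (u t - 1)
      linarith
    have hPδ : ∀ t ∈ Icc (a - δ) (a + δ), |P t| ≤ 1 := by
      intro t ht
      have h := intervalIntegral.norm_integral_le_of_norm_le_const (a := a) (b := t)
        (f := fun s => (u s ^ 2)⁻¹) (C := 4) fun s hs => by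
          have hs' : s ∈ Icc (a - δ) (a + δ) :=
            ordConnected_Icc.uIcc_subset haδ ht (uIoc_subset_uIcc hs)
          have h1 := huδ s hs'
          rw [Real.norm_eq_abs, abs_of_nonneg (by positivity)]
          refine inv_le_of_inv_le₀ (by norm_num) ?_
          nlinarith
      rw [Real.norm_eq_abs] at h
      refine h.trans ?_
      linarith [(hball t).2 ht]
    intro b hb
    have hb' := (hball b).1 hb
    refine ⟨⟨?_, ?_⟩, ?_⟩
    -- The end l cannot lie within δ of a: there |P| ≤ 1, whereas |P(l)| = R > 1. The same holds for
    -- r.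
    · by_contra hbl
      rw [not_lt] at hbl
      have := hPδ l ⟨by linarith [hb'.1], by linarith [hl.2]⟩
      rw [hPl, abs_neg, abs_of_pos (by linarith)] at this
      linarith
    · by_contra hbr
      rw [not_lt] at hbr
      have := hPδ r ⟨by linarith [hr.1], by linarith [hb'.2]⟩
      rw [hPr, abs_of_pos (by linarith)] at this
      linarith
    · rw [abs_div, abs_of_pos (by linarith : 0 < R)]
      exact div_le_div_of_nonneg_right (hPδ b hb') (by linarith)

end Parameter

/-! ### The two-point boundary value problem for nearby points. -/

section BoundaryValue
variable {E : Type*} [NormedAddCommGroup E] [NormedSpace ℝ E] [CompleteSpace E]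

/-- The velocity `v` of the curve starting at `p`, in time `δ t`. -/
theorem exists_boundary_value_lipschitz {G : E × E → E} {M : NNReal} (hG : LipschitzWith M G)
    {B δ : ℝ} (hB : 0 ≤ B) (p e : E) (he : ‖e‖ = 1) (hGB : ‖G (p, e)‖ ≤ B) (hδ : 0 ≤ δ)
    (hδ1 : δ * (16 * (B + M + 1)) ≤ 1) :
    ∃ X v : ℝ → E, X 0 = p ∧ X 1 = p + δ • e ∧ ∀ t ∈ Ioo (-1 : ℝ) 2,
      HasDerivAt X (δ • v t) t ∧ HasDerivAt v (-(δ • G (X t, v t))) t ∧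
      ‖v t - e‖ ≤ 1 / 2 ∧ ‖X t - p‖ ≤ 3 * δ := by
  have hM : (0 : ℝ) ≤ M := M.2
  have hδ2 : δ ≤ 1 / 2 := by nlinarith
  have hδM : δ * M ≤ 1 / 8 := by nlinarith
  -- A time interval larger than [0, 1] puts both endpoints of the segment in the interior.
  have h12 : (-1 : ℝ) ≤ 2 := by norm_num
  set ext : C(Icc (-1 : ℝ) 2, E) → ℝ → E := fun v => IccExtend h12 v with hext
  have hextc : ∀ v, Continuous (ext v) := fun v => v.continuous.Icc_extend'
  set X : C(Icc (-1 : ℝ) 2, E) → ℝ → E := fun v t => p + δ • ∫ s in (0 : ℝ)..t, ext v s with hX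
  have hXd : ∀ v t, HasDerivAt (X v) (δ • ext v t) t := fun v t =>
    (((hextc v).integral_hasStrictDerivAt 0 t).hasDerivAt.const_smul δ).const_add p
  have hXc : ∀ v, Continuous (X v) := fun v =>
    continuous_iff_continuousAt.2 fun t => (hXd v t).continuousAt
  set g : C(Icc (-1 : ℝ) 2, E) → ℝ → E := fun v t => G (X v t, ext v t) with hg
  have hgc : ∀ v, Continuous (g v) := fun v =>
    hG.continuous.comp ((hXc v).prodMk (hextc v))
  set A : C(Icc (-1 : ℝ) 2, E) → ℝ → E := fun v t => ∫ s in (0 : ℝ)..t, g v s with hA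
  have hAd : ∀ v t, HasDerivAt (A v) (g v t) t := fun v t =>
    ((hgc v).integral_hasStrictDerivAt 0 t).hasDerivAt
  have hAc : ∀ v, Continuous (A v) := fun v =>
    continuous_iff_continuousAt.2 fun t => (hAd v t).continuousAt
  -- Subtracting the mean of A over [0, 1] gives S v the mean e there, so a fixed point
  -- automatically reaches p + δe at time 1.
  set S : C(Icc (-1 : ℝ) 2, E) → ℝ → E := fun v t =>
    e - δ • (A v t - ∫ s in (0 : ℝ)..1, A v s) with hS
  have hSd : ∀ v t, HasDerivAt (S v) (-(δ • g v t)) t := fun v t =>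
    (((hAd v t).sub_const _).const_smul δ).const_sub e
  have hSc : ∀ v, Continuous (S v) := fun v =>
    continuous_iff_continuousAt.2 fun t => (hSd v t).continuousAt
  have hsub : ∀ t ∈ Icc (-1 : ℝ) 2, uIcc 0 t ⊆ Icc (-1 : ℝ) 2 := fun t ht =>
    ordConnected_Icc.uIcc_subset (by norm_num) ht
  have habs : ∀ t ∈ Icc (-1 : ℝ) 2, |t - 0| ≤ 2 := fun t ht => by
    rw [sub_zero, abs_le]
    exact ⟨by linarith [ht.1], ht.2⟩
  have hint : ∀ (f : ℝ → E) (D : ℝ), (∀ t ∈ Icc (-1 : ℝ) 2, ‖f t‖ ≤ D) → 0 ≤ D →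
      ∀ t ∈ Icc (-1 : ℝ) 2, ‖∫ s in (0 : ℝ)..t, f s‖ ≤ 2 * D := fun f D hf hD t ht => by
    refine (intervalIntegral.norm_integral_le_of_norm_le_const (C := D) fun s hs =>
      hf s (hsub t ht (uIoc_subset_uIcc hs))).trans ?_
    rw [mul_comm]
    exact mul_le_mul_of_nonneg_right (habs t ht) hD
  have hint1 : ∀ (f : ℝ → E) (D : ℝ), (∀ t ∈ Icc (-1 : ℝ) 2, ‖f t‖ ≤ D) →
      ‖∫ s in (0 : ℝ)..1, f s‖ ≤ D := fun f D hf => by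
    refine (intervalIntegral.norm_integral_le_of_norm_le_const (C := D) fun s hs =>
      hf s (hsub 1 (by norm_num) (uIoc_subset_uIcc hs))).trans ?_
    simp
  set T : C(Icc (-1 : ℝ) 2, E) → C(Icc (-1 : ℝ) 2, E) := fun v =>
    ⟨fun t => S v t, (hSc v).comp continuous_subtype_val⟩ with hT
  have hextdist : ∀ v₁ v₂ : C(Icc (-1 : ℝ) 2, E), ∀ t, ‖ext v₁ t - ext v₂ t‖ ≤ dist v₁ v₂ :=
    fun v₁ v₂ t => by
      rw [← dist_eq_norm]
      exact ContinuousMap.dist_apply_le_dist _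
  have hTd : ∀ v₁ v₂ : C(Icc (-1 : ℝ) 2, E), dist (T v₁) (T v₂) ≤ 1 / 2 * dist v₁ v₂ := by
    intro v₁ v₂
    have hD : 0 ≤ dist v₁ v₂ := dist_nonneg
    refine (ContinuousMap.dist_le (by positivity)).2 fun t => ?_
    have h1 : ∀ t ∈ Icc (-1 : ℝ) 2, ‖X v₁ t - X v₂ t‖ ≤ dist v₁ v₂ := fun t ht => by
      have : X v₁ t - X v₂ t = δ • ∫ s in (0 : ℝ)..t, (ext v₁ s - ext v₂ s) := by
        rw [intervalIntegral.integral_sub ((hextc v₁).intervalIntegrable _ _)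
          ((hextc v₂).intervalIntegrable _ _), smul_sub]
        simp only [hX]
        abel
      rw [this, norm_smul, Real.norm_eq_abs, abs_of_nonneg hδ]
      have := hint (fun s => ext v₁ s - ext v₂ s) _ (fun s _ => hextdist v₁ v₂ s) hD t ht
      nlinarith
    have h2 : ∀ t ∈ Icc (-1 : ℝ) 2, ‖g v₁ t - g v₂ t‖ ≤ M * dist v₁ v₂ := fun t ht => by
      rw [← dist_eq_norm]
      refine (hG.dist_le_mul _ _).trans (mul_le_mul_of_nonneg_left ?_ hM)
      rw [Prod.dist_eq, dist_eq_norm, dist_eq_norm]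
      exact max_le (h1 t ht) (hextdist v₁ v₂ t)
    have h3 : ∀ t ∈ Icc (-1 : ℝ) 2, ‖A v₁ t - A v₂ t‖ ≤ 2 * (M * dist v₁ v₂) := fun t ht => by
      simp only [hA]
      rw [← intervalIntegral.integral_sub ((hgc v₁).intervalIntegrable _ _)
          ((hgc v₂).intervalIntegrable _ _)]
      exact hint _ _ h2 (by positivity) t ht
    have h4 := hint1 _ _ h3
    rw [intervalIntegral.integral_sub ((hAc v₁).intervalIntegrable _ _)
          ((hAc v₂).intervalIntegrable _ _)] at h4
    have h5 : S v₁ t - S v₂ t = -(δ • ((A v₁ t - A v₂ t) -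
        ((∫ s in (0 : ℝ)..1, A v₁ s) - ∫ s in (0 : ℝ)..1, A v₂ s))) := by
      simp only [hS, smul_sub]
      abel
    change dist (S v₁ t) (S v₂ t) ≤ _
    rw [dist_eq_norm, h5, norm_neg, norm_smul, Real.norm_eq_abs, abs_of_nonneg hδ]
    have h6 := (norm_sub_le _ _).trans (add_le_add (h3 t t.2) h4)
    calc _ ≤ δ * (2 * (M * dist v₁ v₂) + 2 * (M * dist v₁ v₂)) := mul_le_mul_of_nonneg_left h6 hδ
      _ = 4 * (δ * M) * dist v₁ v₂ := by ring
      _ ≤ 1 / 2 * dist v₁ v₂ := by nlinarith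
  have hcontr : ContractingWith (1 / 2) T :=
    ⟨by norm_num, LipschitzWith.of_dist_le_mul fun v₁ v₂ => by simpa using hTd v₁ v₂⟩
  set v₀ : C(Icc (-1 : ℝ) 2, E) := ContinuousMap.const _ e with hv₀
  set v := hcontr.fixedPoint T with hv
  have hfix : T v = v := hcontr.fixedPoint_isFixedPt
  have hextS : ∀ t ∈ Icc (-1 : ℝ) 2, ext v t = S v t := fun t ht => by
    simp only [hext]
    rw [IccExtend_of_mem h12 _ ht]
    conv_lhs => rw [← hfix]
    rfl
  have hext0 : ∀ t, ext v₀ t = e := fun t => rfl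
  -- The first iterate of the constant e moves by at most 1/4; with contraction factor 1/2 the fixed
  -- point is within 1/2 of e, hence never zero.
  have hT0 : dist v₀ (T v₀) ≤ 1 / 4 := by
    have h1 : ∀ t ∈ Icc (-1 : ℝ) 2, ‖X v₀ t - p‖ ≤ 1 := fun t ht => by
      simp only [hX, add_sub_cancel_left, norm_smul, Real.norm_eq_abs, abs_of_nonneg hδ]
      have := hint (ext v₀) 1 (fun s _ => by rw [hext0, he]) zero_le_one t ht
      nlinarith
    have h2 : ∀ t ∈ Icc (-1 : ℝ) 2, ‖g v₀ t‖ ≤ B + M := fun t ht => by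
      have h3 := hG.dist_le_mul (X v₀ t, e) (p, e)
      rw [dist_eq_norm, Prod.dist_eq, dist_self, dist_eq_norm, max_eq_left (norm_nonneg _)] at h3
      have h4 := norm_le_norm_add_norm_sub' (g v₀ t) (G (p, e))
      have h5 : ‖g v₀ t - G (p, e)‖ ≤ M * 1 :=
        h3.trans (mul_le_mul_of_nonneg_left (h1 t ht) hM)
      linarith
    have h3 : ∀ t ∈ Icc (-1 : ℝ) 2, ‖A v₀ t‖ ≤ 2 * (B + M) := hint _ _ h2 (by positivity)
    have h4 := hint1 _ _ h3
    refine (ContinuousMap.dist_le (by norm_num)).2 fun t => ?_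
    change dist e (S v₀ t) ≤ _
    have h5 := (norm_sub_le (A v₀ t) (∫ s in (0 : ℝ)..1, A v₀ s)).trans (add_le_add (h3 t t.2) h4)
    rw [dist_eq_norm]
    simp only [hS, sub_sub_cancel, norm_smul, Real.norm_eq_abs, abs_of_nonneg hδ]
    calc _ ≤ δ * (2 * (B + M) + 2 * (B + M)) := mul_le_mul_of_nonneg_left h5 hδ
      _ ≤ 1 / 4 := by nlinarith
  have hv0 : dist v₀ v ≤ 1 / 2 := by
    have := dist_triangle v₀ (T v₀) (T v)
    have h2 := hTd v₀ v
    rw [hfix] at this h2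
    linarith
  have hve : ∀ t, ‖ext v t - e‖ ≤ 1 / 2 := fun t => by
    have := hextdist v v₀ t
    rw [hext0, dist_comm] at this
    exact this.trans hv0
  refine ⟨X v, S v, by simp [hX], ?_, fun t ht => ?_⟩
  · have h1 : ∫ s in (0 : ℝ)..1, ext v s = ∫ s in (0 : ℝ)..1, S v s :=
      intervalIntegral.integral_congr fun s hs => hextS s (hsub 1 (by norm_num) hs)
    have h2 : ∫ s in (0 : ℝ)..1, S v s = e := by
      simp only [hS]
      have h3 : Continuous fun s => δ • (A v s - ∫ s in (0 : ℝ)..1, A v s) :=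
        ((hAc v).sub continuous_const).const_smul δ
      rw [intervalIntegral.integral_sub (continuous_const.intervalIntegrable _ _)
        (h3.intervalIntegrable _ _), intervalIntegral.integral_smul,
        intervalIntegral.integral_sub ((hAc v).intervalIntegrable _ _)
          (continuous_const.intervalIntegrable _ _)]
      simp
    simp only [hX]
    rw [h1, h2]
  · have ht' := Ioo_subset_Icc_self ht
    refine ⟨?_, ?_, ?_, ?_⟩
    · rw [← hextS t ht']
      exact hXd v t
    · have := hSd v t
      simp only [hg] at this
      rwa [hextS t ht'] at this
    · rw [← hextS t ht']
      exact hve t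
    · simp only [hX, add_sub_cancel_left, norm_smul, Real.norm_eq_abs, abs_of_nonneg hδ]
      have := hint (ext v) (3 / 2) (fun s _ => by
        have h1 := norm_le_norm_add_norm_sub' (ext v s) e
        have h2 := hve s
        rw [he] at h1
        linarith) (by norm_num) t ht'
      nlinarith

/-- The boundary value problem for `x'' + G(x, x') = 0` with `G` homogeneous of degree two. -/
theorem exists_boundary_value {E : Type*} [NormedAddCommGroup E] [NormedSpace ℝ E]
    [FiniteDimensional ℝ E] {G : E × E → E} {U : Set E} (hU : IsOpen U) {p : E} (hp : p ∈ U)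
    (hG : ContDiffOn ℝ 1 G {z | z.1 ∈ U ∧ z.2 ≠ 0})
    (hhom : ∀ x ∈ U, ∀ y ≠ 0, ∀ c : ℝ, 0 < c → G (x, c • y) = c ^ 2 • G (x, y)) :
    ∃ r > 0, ∀ q, q ≠ p → dist q p < r → ∃ x y : ℝ → E, x 0 = p ∧ x 1 = q ∧
      ∀ t ∈ Ioo (-1 : ℝ) 2, x t ∈ U ∧ y t ≠ 0 ∧ HasDerivAt x (y t) t ∧
        HasDerivAt y (-G (x t, y t)) t := by
  have := FiniteDimensional.complete ℝ E
  have := FiniteDimensional.proper_real E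
  have hΩ : IsOpen {z : E × E | z.1 ∈ U ∧ z.2 ≠ 0} :=
    (hU.preimage continuous_fst).inter (isOpen_ne.preimage continuous_snd)
  obtain ⟨r₀, hr₀, hr₀U⟩ := Metric.nhds_basis_closedBall.mem_iff.1 (hU.mem_nhds hp)
  -- A compact shell avoiding zero velocity. It contains the set V below for every unit direction e,
  -- so the bounds on G and its derivative are uniform in q.
  set S : Set (E × E) :=
    Metric.closedBall p r₀ ×ˢ (Metric.closedBall 0 (3 / 2) ∩ {y | 1 / 2 ≤ ‖y‖}) with hS
  have hSc : IsCompact S := (isCompact_closedBall p r₀).prod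
    ((isCompact_closedBall 0 (3 / 2)).inter_right (isClosed_le continuous_const continuous_norm))
  have hSΩ : S ⊆ {z : E × E | z.1 ∈ U ∧ z.2 ≠ 0} := by
    rintro ⟨x, y⟩ ⟨hx, -, hy⟩
    refine ⟨hr₀U hx, fun h => ?_⟩
    dsimp only at h hy
    rw [h, mem_ofPred_eq, norm_zero] at hy
    norm_num at hy
  obtain ⟨B, hB⟩ := hSc.exists_bound_of_continuousOn (hG.continuousOn.mono hSΩ)
  obtain ⟨D, hD⟩ := hSc.exists_bound_of_continuousOn
    ((hG.continuousOn_fderiv_of_isOpen hΩ le_rfl).mono hSΩ)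
  set M : NNReal := lipschitzExtensionConstant E * D.toNNReal with hM
  set B' : ℝ := max B 0 with hB'
  have hB'0 : 0 ≤ B' := le_max_right _ _
  have hM0 : (0 : ℝ) ≤ M := M.2
  -- The solution strays at most 3δ from p, which must stay below r₀; the second term makes the
  -- contraction work.
  refine ⟨min (r₀ / 3) (16 * (B' + M + 1))⁻¹, by positivity, fun q hqp hq => ?_⟩
  set δ : ℝ := ‖q - p‖ with hδ
  have hδ0 : 0 < δ := norm_pos_iff.2 (sub_ne_zero.2 hqp)
  rw [dist_eq_norm, lt_min_iff] at hq
  have hq2 : δ * (16 * (B' + M + 1)) ≤ 1 := by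
    have := (lt_inv_comm₀ hδ0 (by positivity)).1 hq.2
    rw [mul_comm, ← le_div_iff₀ hδ0, one_div]
    exact this.le
  set e : E := δ⁻¹ • (q - p) with he
  have he1 : ‖e‖ = 1 := by
    rw [he, norm_smul, norm_inv, Real.norm_eq_abs, abs_of_pos hδ0, ← hδ, inv_mul_cancel₀ hδ0.ne']
  have hδe : δ • e = q - p := by rw [he, smul_inv_smul₀ hδ0.ne']
  set V : Set (E × E) := Metric.closedBall p r₀ ×ˢ Metric.closedBall e (1 / 2) with hV
  have hVS : V ⊆ S := by
    rintro ⟨x, y⟩ ⟨hx, hy⟩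
    rw [mem_closedBall_iff_norm] at hy
    dsimp only at hy
    refine ⟨hx, ?_, ?_⟩
    · rw [mem_closedBall_zero_iff]
      have := norm_le_norm_add_norm_sub' y e
      dsimp only
      linarith
    · have := norm_le_norm_add_norm_sub' e y
      rw [norm_sub_rev] at this
      rw [mem_ofPred_eq]
      linarith
  have hlip : LipschitzOnWith D.toNNReal G V := by
    refine Convex.lipschitzOnWith_of_nnnorm_fderiv_le (𝕜 := ℝ) (fun z hz => ?_) (fun z hz => ?_)
      ((convex_closedBall p r₀).prod (convex_closedBall e (1 / 2)))
    · exact (hG.contDiffAt (hΩ.mem_nhds (hSΩ (hVS hz)))).differentiableAt one_ne_zero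
    · rw [← norm_toNNReal]
      exact Real.toNNReal_le_toNNReal (hD z (hVS hz))
  -- V is convex, so the derivative bound makes G Lipschitz on it. The global extension depends on
  -- e, but its constant does not; the solution stays in V, where G' agrees with G.
  obtain ⟨G', hG', hGG'⟩ := hlip.extend_finite_dimension
  have hpV : (p, e) ∈ V :=
    ⟨Metric.mem_closedBall_self hr₀.le, Metric.mem_closedBall_self (by norm_num)⟩
  obtain ⟨X, v, hX0, hX1, hXv⟩ := exists_boundary_value_lipschitz hG' hB'0 p e he1
    (by rw [← hGG' hpV]; exact (hB _ (hVS hpV)).trans (le_max_left _ _)) hδ0.le hq2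
  refine ⟨X, fun t => δ • v t, hX0, by rw [hX1, hδe, add_sub_cancel], fun t ht => ?_⟩
  obtain ⟨h1, h2, h3, h4⟩ := hXv t ht
  have hmem : (X t, v t) ∈ V := by
    refine ⟨?_, ?_⟩
    · rw [mem_closedBall_iff_norm]
      exact h4.trans (by linarith)
    · rw [mem_closedBall_iff_norm]
      exact h3
  have hΩt := hSΩ (hVS hmem)
  refine ⟨hΩt.1, smul_ne_zero hδ0.ne' hΩt.2, h1, ?_⟩
  -- By homogeneity G(x, δv) = δ²G(x, v): one factor δ comes from v' = -δG, the other from y = δv.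
  rw [hhom _ hΩt.1 _ hΩt.2 δ hδ0, hGG' hmem]
  refine (h2.const_smul δ).congr_deriv ?_
  rw [smul_neg, smul_smul, pow_two]

end BoundaryValue

/-! ### Tensoriality of the curvature of a spray. -/

section Spray
variable {E F : Type*} [NormedAddCommGroup E] [NormedSpace ℝ E] [NormedAddCommGroup F]
  [NormedSpace ℝ F]

/-- The map induced by `φ` on the tangent bundle. -/
def tangentLift (φ : E → E) (z : E × E) : E × E := (φ z.1, fderiv ℝ φ z.1 z.2)

/-- The operator `2 F² R` of a spray `G`. -/
def curvatureOp (G : E × E → E) (z : E × E) (η : E) : E :=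
  (2 : ℝ) • fderiv ℝ G z (η, 0) - fderiv ℝ (fderiv ℝ G) z (z.2, -G z) (0, η) -
    (1 / 2 : ℝ) • fderiv ℝ G z (0, fderiv ℝ G z (0, η))

theorem two_le_smoothness : minSmoothness ℝ 2 ≤ (∞ : WithTop ℕ∞) := by
  rw [minSmoothness_of_isRCLikeNormedField]
  norm_cast

/-- Identities between derivatives are obtained below by differentiating an equation along such a
curve in two ways and invoking uniqueness of the derivative. -/
theorem exists_curve (z a : E) : ∃ c : ℝ → E, c 0 = z ∧ HasDerivAt c a 0 :=
  ⟨fun t => z + t • a, by simp, by simpa using ((hasDerivAt_id (0 : ℝ)).smul_const a).const_add z⟩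

theorem hasDerivAt_comp_curve {f : E → F} {c : ℝ → E} {z a : E} (hf : DifferentiableAt ℝ f z)
    (hc0 : c 0 = z) (hc : HasDerivAt c a 0) :
    HasDerivAt (fun t => f (c t)) (fderiv ℝ f z a) 0 := by
  subst hc0
  exact hf.hasFDerivAt.comp_hasDerivAt 0 hc

theorem hasDerivAt_fst {c : ℝ → E × F} {a : E × F} (hc : HasDerivAt c a 0) :
    HasDerivAt (fun t => (c t).1) a.1 0 :=
  ((hasFDerivAt_fst (𝕜 := ℝ) (p := c 0)).comp_hasDerivAt 0 hc :)

theorem hasDerivAt_snd {c : ℝ → E × F} {a : E × F} (hc : HasDerivAt c a 0) :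
    HasDerivAt (fun t => (c t).2) a.2 0 :=
  ((hasFDerivAt_snd (𝕜 := ℝ) (p := c 0)).comp_hasDerivAt 0 hc :)

theorem eventually_mem_curve {c : ℝ → E} {a : E} {W : Set E} (hW : IsOpen W) (hc0 : c 0 ∈ W)
    (hc : HasDerivAt c a 0) : ∀ᶠ t in 𝓝 (0 : ℝ), c t ∈ W :=
  hc.continuousAt.eventually_mem (hW.mem_nhds hc0)

theorem hasDerivAt_tangentLift {φ : E → E} {c : ℝ → E × E} {z a : E × E}
    (hφ : ContDiffAt ℝ 2 φ z.1) (hc0 : c 0 = z) (hc : HasDerivAt c a 0) :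
    HasDerivAt (fun t => tangentLift φ (c t))
      (fderiv ℝ φ z.1 a.1, fderiv ℝ (fderiv ℝ φ) z.1 a.1 z.2 + fderiv ℝ φ z.1 a.2) 0 := by
  have h1 := hasDerivAt_comp_curve (hφ.differentiableAt two_ne_zero) (by rw [hc0])
    (hasDerivAt_fst hc)
  have h2 := hasDerivAt_comp_curve ((hφ.fderiv_right (m := 1) le_rfl).differentiableAt one_ne_zero)
    (by rw [hc0]) (hasDerivAt_fst hc)
  have h3 := h2.clm_apply (hasDerivAt_snd hc)
  rw [hc0] at h3
  exact h1.prodMk h3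

/-- The operator combines 2 G_x η, the derivative of G_y η along the spray field (y, -G), and ½
G_y(G_y η). Applying the chain rule to the transformation law of G produces second and third
derivatives of φ; in this combination they cancel by symmetry. -/
theorem curvatureOp_tangentLift {φ : E → E} {D : Set E} (hD : IsOpen D)
    (hφ : ContDiffOn ℝ ∞ φ D) {G G' : E × E → E} {W W' : Set (E × E)} (hW : IsOpen W)
    (hWD : ∀ z ∈ W, z.1 ∈ D)
    (hW' : IsOpen W') (hWW' : ∀ z ∈ W, tangentLift φ z ∈ W')
    (hG : ContDiffOn ℝ ∞ G W) (hG' : ContDiffOn ℝ ∞ G' W')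
    (h : ∀ z ∈ W, G' (tangentLift φ z) =
      fderiv ℝ φ z.1 (G z) - fderiv ℝ (fderiv ℝ φ) z.1 z.2 z.2)
    {z : E × E} (hz : z ∈ W) (η : E) :
    curvatureOp G' (tangentLift φ z) (fderiv ℝ φ z.1 η) =
      fderiv ℝ φ z.1 (curvatureOp G z η) := by
  have cφ : ∀ z ∈ W, ContDiffAt ℝ ∞ φ z.1 := fun z hz => hφ.contDiffAt (hD.mem_nhds (hWD z hz))
  have cG : ∀ z ∈ W, ContDiffAt ℝ ∞ G z := fun z hz => hG.contDiffAt (hW.mem_nhds hz)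
  have cG' : ∀ z ∈ W, ContDiffAt ℝ ∞ G' (tangentLift φ z) := fun z hz =>
    hG'.contDiffAt (hW'.mem_nhds (hWW' z hz))
  have dA : ∀ z ∈ W, DifferentiableAt ℝ (fderiv ℝ φ) z.1 := fun z hz =>
    ((cφ z hz).fderiv_right (m := 1) (by norm_cast)).differentiableAt one_ne_zero
  have dB : ∀ z ∈ W, DifferentiableAt ℝ (fderiv ℝ (fderiv ℝ φ)) z.1 := fun z hz =>
    (((cφ z hz).fderiv_right (m := ∞) le_rfl).fderiv_right
      (m := 1) (by norm_cast)).differentiableAt one_ne_zero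
  have dG : ∀ z ∈ W, DifferentiableAt ℝ G z := fun z hz => (cG z hz).differentiableAt (by simp)
  have dG' : ∀ z ∈ W, DifferentiableAt ℝ G' (tangentLift φ z) := fun z hz =>
    (cG' z hz).differentiableAt (by simp)
  have dDG : DifferentiableAt ℝ (fderiv ℝ G) z :=
    ((cG z hz).fderiv_right (m := 1) (by norm_cast)).differentiableAt one_ne_zero
  have dDG' : DifferentiableAt ℝ (fderiv ℝ G') (tangentLift φ z) :=
    ((cG' z hz).fderiv_right (m := 1) (by norm_cast)).differentiableAt one_ne_zero
  have hB : ∀ z ∈ W, ∀ u v, fderiv ℝ (fderiv ℝ φ) z.1 u v = fderiv ℝ (fderiv ℝ φ) z.1 v u :=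
    fun z hz u v => ((cφ z hz).isSymmSndFDerivAt two_le_smoothness) u v
  have hC : ∀ u v, fderiv ℝ (fderiv ℝ (fderiv ℝ φ)) z.1 u v =
      fderiv ℝ (fderiv ℝ (fderiv ℝ φ)) z.1 v u := fun u v =>
    (((cφ z hz).fderiv_right (m := ∞) le_rfl).isSymmSndFDerivAt two_le_smoothness) u v
  -- the derivative of the transformation rule in an arbitrary direction
  have h1 : ∀ z ∈ W, ∀ a : E × E, fderiv ℝ G' (tangentLift φ z)
      (fderiv ℝ φ z.1 a.1, fderiv ℝ (fderiv ℝ φ) z.1 a.1 z.2 + fderiv ℝ φ z.1 a.2) =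
      fderiv ℝ (fderiv ℝ φ) z.1 a.1 (G z) + fderiv ℝ φ z.1 (fderiv ℝ G z a) -
        (fderiv ℝ (fderiv ℝ (fderiv ℝ φ)) z.1 a.1 z.2 z.2 +
          fderiv ℝ (fderiv ℝ φ) z.1 a.2 z.2 + fderiv ℝ (fderiv ℝ φ) z.1 z.2 a.2) := by
    intro z hz a
    obtain ⟨c, hc0, hc⟩ := exists_curve z a
    have e1 := hasDerivAt_comp_curve (dG' z hz) (by rw [hc0])
      (hasDerivAt_tangentLift ((cφ z hz).of_le (by norm_cast)) hc0 hc)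
    have e2 := (hasDerivAt_comp_curve (dA z hz) (by rw [hc0]) (hasDerivAt_fst hc)).clm_apply
      (hasDerivAt_comp_curve (dG z hz) hc0 hc)
    have e3 := ((hasDerivAt_comp_curve (dB z hz) (by rw [hc0]) (hasDerivAt_fst hc)).clm_apply
      (hasDerivAt_snd hc)).clm_apply (hasDerivAt_snd hc)
    have e4 := (e2.sub e3).congr_of_eventuallyEq (f₁ := fun t => G' (tangentLift φ (c t)))
      ((eventually_mem_curve hW (by rwa [hc0]) hc).mono fun t ht => h _ ht)
    rw [e1.unique e4, hc0]
    simp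
  -- The vertical case is needed on all of W, because it is differentiated once more below.
  have h2 : ∀ z ∈ W, ∀ u : E, fderiv ℝ G' (tangentLift φ z) (0, fderiv ℝ φ z.1 u) =
      fderiv ℝ φ z.1 (fderiv ℝ G z (0, u)) - (2 : ℝ) • fderiv ℝ (fderiv ℝ φ) z.1 u z.2 := by
    intro z hz u
    have := h1 z hz (0, u)
    simp only [map_zero, zero_apply, zero_add] at this
    rw [this, hB z hz z.2 u, two_smul]
  have h3 := h1 z hz (η, 0)
  simp only [map_zero, zero_apply, add_zero] at h3
  -- The vertical identity differentiated along the spray direction (y, -G).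
  have h4 : fderiv ℝ (fderiv ℝ G') (tangentLift φ z)
        ((tangentLift φ z).2, -G' (tangentLift φ z)) (0, fderiv ℝ φ z.1 η) +
      fderiv ℝ G' (tangentLift φ z) (0, fderiv ℝ (fderiv ℝ φ) z.1 z.2 η) =
      fderiv ℝ (fderiv ℝ φ) z.1 z.2 (fderiv ℝ G z (0, η)) +
        fderiv ℝ φ z.1 (fderiv ℝ (fderiv ℝ G) z (z.2, -G z) (0, η)) -
      (2 : ℝ) • (fderiv ℝ (fderiv ℝ (fderiv ℝ φ)) z.1 z.2 η z.2 -
        fderiv ℝ (fderiv ℝ φ) z.1 η (G z)) := by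
    obtain ⟨c, hc0, hc⟩ := exists_curve z (z.2, -G z)
    have dc := hasDerivAt_comp_curve (dA z hz) (by rw [hc0]) (hasDerivAt_fst hc)
    have e1 := (hasDerivAt_comp_curve dDG' (by rw [hc0])
      (hasDerivAt_tangentLift ((cφ z hz).of_le (by norm_cast)) hc0 hc)).clm_apply
      ((hasDerivAt_const (0 : ℝ) (0 : E)).prodMk (dc.clm_apply (hasDerivAt_const (0 : ℝ) η)))
    have e2 := dc.clm_apply ((hasDerivAt_comp_curve dDG hc0 hc).clm_apply
      (hasDerivAt_const (0 : ℝ) ((0 : E), η)))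
    have e3 := (((hasDerivAt_comp_curve (dB z hz) (by rw [hc0]) (hasDerivAt_fst hc)).clm_apply
      (hasDerivAt_const (0 : ℝ) η)).clm_apply (hasDerivAt_snd hc)).const_smul (2 : ℝ)
    have e4 := (e2.sub e3).congr_of_eventuallyEq
      (f₁ := fun t => fderiv ℝ G' (tangentLift φ (c t)) (0, fderiv ℝ φ (c t).1 η))
      ((eventually_mem_curve hW (by rwa [hc0]) hc).mono fun t ht => h2 _ ht η)
    have e5 := e1.unique e4
    rw [hc0] at e5
    simp only [map_zero, add_zero, map_neg] at e5
    -- The transformation law says precisely that the tangent lift carries the spray field of G to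
    -- that of G'.
    have hS : (fderiv ℝ φ z.1 z.2, fderiv ℝ (fderiv ℝ φ) z.1 z.2 z.2 + -fderiv ℝ φ z.1 (G z)) =
        ((tangentLift φ z).2, -G' (tangentLift φ z)) := by
      rw [h z hz, neg_sub, sub_eq_add_neg]
      rfl
    rw [hS] at e5
    rw [e5]
    simp [sub_eq_add_neg]
  have hadd : ∀ u v : E, fderiv ℝ G' (tangentLift φ z) (u, v) =
      fderiv ℝ G' (tangentLift φ z) (u, 0) + fderiv ℝ G' (tangentLift φ z) (0, v) := fun u v => by
    rw [← map_add]
    simp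
  have hsub : ∀ u v : E, fderiv ℝ G' (tangentLift φ z) (0, u - (2 : ℝ) • v) =
      fderiv ℝ G' (tangentLift φ z) (0, u) - (2 : ℝ) • fderiv ℝ G' (tangentLift φ z) (0, v) :=
    fun u v => by
      rw [← map_smul, ← map_sub]
      simp
  rw [hadd] at h3
  rw [curvatureOp, curvatureOp, h2 z hz η, hsub, h2 z hz, eq_sub_of_add_eq h3, eq_sub_of_add_eq h4,
    hB z hz z.2 η, hC z.2 η, hB z hz z.2 (fderiv ℝ G z (0, η))]
  simp only [map_sub, map_smul]
  module

end Spray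

/-! ### Smoothness of the coordinate tensors and the Euler-Lagrange identity. -/

section Coordinates
variable {n : ℕ}

/-- The part of `U × ℝⁿ` with nonzero second component. -/
def slit (U : Set (Coord n)) : Set (Coord n × Coord n) := {z | z.1 ∈ U ∧ z.2 ≠ 0}

theorem isOpen_slit {U : Set (Coord n)} (hU : IsOpen U) : IsOpen (slit U) :=
  (hU.preimage continuous_fst).inter (isOpen_ne.preimage continuous_snd)

/-- Passing to the total derivative on the product makes smoothness, the chain rule and the symmetry
of second derivatives available. -/
theorem dX_eq {f : Coord n → Coord n → ℝ} {z : Coord n × Coord n}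
    (hf : DifferentiableAt ℝ (fun z : Coord n × Coord n => f z.1 z.2) z) (i : Fin n) :
    dX i f z.1 z.2 = fderiv ℝ (fun z : Coord n × Coord n => f z.1 z.2) z
      (EuclideanSpace.single i 1, 0) := by
  have h := hf.hasFDerivAt.comp (z.1) (hasFDerivAt_prodMk_left (𝕜 := ℝ) z.1 z.2)
  rw [dX]
  erw [h.fderiv]
  simp

theorem dY_eq {f : Coord n → Coord n → ℝ} {z : Coord n × Coord n}
    (hf : DifferentiableAt ℝ (fun z : Coord n × Coord n => f z.1 z.2) z) (i : Fin n) :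
    dY i f z.1 z.2 = fderiv ℝ (fun z : Coord n × Coord n => f z.1 z.2) z
      (0, EuclideanSpace.single i 1) := by
  have h := hf.hasFDerivAt.comp (z.2) (hasFDerivAt_prodMk_right (𝕜 := ℝ) z.1 z.2)
  rw [dY]
  erw [h.fderiv]
  simp

section Smooth
variable {W : Set (Coord n × Coord n)} {f : Coord n → Coord n → ℝ}

theorem differentiableAt_of_contDiffOn {F : Type*} [NormedAddCommGroup F] [NormedSpace ℝ F]
    {g : Coord n × Coord n → F} (hW : IsOpen W) (hg : ContDiffOn ℝ ∞ g W)
    {z : Coord n × Coord n} (hz : z ∈ W) : DifferentiableAt ℝ g z :=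
  (hg.contDiffAt (hW.mem_nhds hz)).differentiableAt (by simp)

theorem contDiffOn_fderiv_apply {F : Type*} [NormedAddCommGroup F] [NormedSpace ℝ F]
    {g : Coord n × Coord n → F} (hW : IsOpen W) (hg : ContDiffOn ℝ ∞ g W)
    (a : Coord n × Coord n) : ContDiffOn ℝ ∞ (fun z => fderiv ℝ g z a) W :=
  (hg.fderiv_of_isOpen hW (m := ∞) le_rfl).clm_apply contDiffOn_const

theorem contDiffOn_dX (hW : IsOpen W)
    (hf : ContDiffOn ℝ ∞ (fun z : Coord n × Coord n => f z.1 z.2) W) (i : Fin n) :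
    ContDiffOn ℝ ∞ (fun z : Coord n × Coord n => dX i f z.1 z.2) W :=
  (contDiffOn_fderiv_apply hW hf _).congr fun _ hz =>
    dX_eq (differentiableAt_of_contDiffOn hW hf hz) i

theorem contDiffOn_dY (hW : IsOpen W)
    (hf : ContDiffOn ℝ ∞ (fun z : Coord n × Coord n => f z.1 z.2) W) (i : Fin n) :
    ContDiffOn ℝ ∞ (fun z : Coord n × Coord n => dY i f z.1 z.2) W :=
  (contDiffOn_fderiv_apply hW hf _).congr fun _ hz =>
    dY_eq (differentiableAt_of_contDiffOn hW hf hz) i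

theorem fderiv_fderiv_apply_const {F : Type*} [NormedAddCommGroup F] [NormedSpace ℝ F]
    {g : Coord n × Coord n → F} (hW : IsOpen W) (hg : ContDiffOn ℝ ∞ g W)
    {z : Coord n × Coord n} (hz : z ∈ W) (a b : Coord n × Coord n) :
    fderiv ℝ (fun z => fderiv ℝ g z b) z a = fderiv ℝ (fderiv ℝ g) z a b := by
  have h : DifferentiableAt ℝ (fderiv ℝ g) z :=
    differentiableAt_of_contDiffOn hW (hg.fderiv_of_isOpen hW (m := ∞) le_rfl) hz
  rw [fderiv_clm_apply h (differentiableAt_const b)]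
  simp

theorem fderiv_congr_dY (hW : IsOpen W)
    (hf : ContDiffOn ℝ ∞ (fun z : Coord n × Coord n => f z.1 z.2) W) {z : Coord n × Coord n}
    (hz : z ∈ W) (j : Fin n) :
    fderiv ℝ (fun z : Coord n × Coord n => dY j f z.1 z.2) z =
      fderiv ℝ (fun z => fderiv ℝ (fun z : Coord n × Coord n => f z.1 z.2) z
        (0, EuclideanSpace.single j 1)) z :=
  Filter.EventuallyEq.fderiv_eq (Filter.eventuallyEq_of_mem (hW.mem_nhds hz) fun _ hx =>
    dY_eq (differentiableAt_of_contDiffOn hW hf hx) j)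

theorem dX_dY_eq (hW : IsOpen W)
    (hf : ContDiffOn ℝ ∞ (fun z : Coord n × Coord n => f z.1 z.2) W) {z : Coord n × Coord n}
    (hz : z ∈ W) (i j : Fin n) :
    dX i (dY j f) z.1 z.2 = fderiv ℝ (fderiv ℝ (fun z : Coord n × Coord n => f z.1 z.2)) z
      (EuclideanSpace.single i 1, 0) (0, EuclideanSpace.single j 1) := by
  rw [dX_eq (differentiableAt_of_contDiffOn hW (contDiffOn_dY hW hf j) hz),
    fderiv_congr_dY hW hf hz, fderiv_fderiv_apply_const hW hf hz]

theorem dY_dY_eq (hW : IsOpen W)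
    (hf : ContDiffOn ℝ ∞ (fun z : Coord n × Coord n => f z.1 z.2) W) {z : Coord n × Coord n}
    (hz : z ∈ W) (i j : Fin n) :
    dY i (dY j f) z.1 z.2 = fderiv ℝ (fderiv ℝ (fun z : Coord n × Coord n => f z.1 z.2)) z
      (0, EuclideanSpace.single i 1) (0, EuclideanSpace.single j 1) := by
  rw [dY_eq (differentiableAt_of_contDiffOn hW (contDiffOn_dY hW hf j) hz),
    fderiv_congr_dY hW hf hz, fderiv_fderiv_apply_const hW hf hz]

end Smooth

theorem dY_const_mul (c : ℝ) (f : Coord n → Coord n → ℝ) (i : Fin n) :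
    dY i (fun x y => c * f x y) = fun x y => c * dY i f x y := by
  funext x y
  change fderiv ℝ (c • fun z => f x z) y _ = _
  rw [fderiv_const_smul_field]
  rfl

theorem map_eq_sum {F : Type*} [AddCommGroup F] [Module ℝ F] (T : Coord n →ₗ[ℝ] F) (v : Coord n) :
    T v = ∑ i, v i • T (EuclideanSpace.single i 1) := by
  conv_lhs => rw [← (EuclideanSpace.basisFun (Fin n) ℝ).sum_repr v]
  simp

/-- `L` is the expression of a Finsler structure in coordinates on the open set `U`. -/
structure IsLocalFinsler (L : Coord n → Coord n → ℝ) (U : Set (Coord n)) : Prop where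
  isOpen : IsOpen U
  smooth : ContDiffOn ℝ ∞ (fun z : Coord n × Coord n => L z.1 z.2) (slit U)
  homogeneous : ∀ x y, ∀ c : ℝ, 0 < c → L x (c • y) = c * L x y
  posDef : ∀ x ∈ U, ∀ y ≠ 0, (metricMatrix L x y).PosDef

/-- The square `F²` as a function on the product. -/
def sq (L : Coord n → Coord n → ℝ) (z : Coord n × Coord n) : ℝ := L z.1 z.2 ^ 2

/-- The vector of the spray coefficients. -/
def sprayVec (L : Coord n → Coord n → ℝ) (z : Coord n × Coord n) : Coord n :=
  WithLp.toLp 2 fun i => sprayCoeff L i z.1 z.2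

theorem contDiffOn_det {m : Type*} [Fintype m] [DecidableEq m]
    {A : Coord n × Coord n → Matrix m m ℝ} {W : Set (Coord n × Coord n)}
    (hA : ∀ i j, ContDiffOn ℝ ∞ (fun z => A z i j) W) :
    ContDiffOn ℝ ∞ (fun z => (A z).det) W := by
  simp only [Matrix.det_apply']
  exact ContDiffOn.sum fun σ _ => contDiffOn_const.mul (contDiffOn_prod fun i _ => hA _ _)

namespace IsLocalFinsler
variable {L : Coord n → Coord n → ℝ} {U : Set (Coord n)}

theorem isOpen_slit (hL : IsLocalFinsler L U) : IsOpen (slit U) := Finsler.isOpen_slit hL.isOpen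

theorem contDiffOn_sq (hL : IsLocalFinsler L U) : ContDiffOn ℝ ∞ (sq L) (slit U) := hL.smooth.pow 2

theorem metricMatrix_eq (hL : IsLocalFinsler L U) {z : Coord n × Coord n} (hz : z ∈ slit U) (i j : Fin n) :
    metricMatrix L z.1 z.2 i j = 1 / 2 * fderiv ℝ (fderiv ℝ (sq L)) z
      (0, EuclideanSpace.single i 1) (0, EuclideanSpace.single j 1) := by
  rw [metricMatrix, Matrix.of_apply, dY_const_mul, dY_const_mul]
  change 1 / 2 * dY i (dY j fun x y => L x y ^ 2) z.1 z.2 = _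
  rw [dY_dY_eq hL.isOpen_slit hL.contDiffOn_sq hz]
  rfl

theorem contDiffOn_metricMatrix (hL : IsLocalFinsler L U) (i j : Fin n) :
    ContDiffOn ℝ ∞ (fun z : Coord n × Coord n => metricMatrix L z.1 z.2 i j) (slit U) := by
  simp only [metricMatrix, Matrix.of_apply]
  refine contDiffOn_dY hL.isOpen_slit (contDiffOn_dY hL.isOpen_slit ?_ j) i
  exact contDiffOn_const.mul hL.contDiffOn_sq

/-- Cramer's rule, the determinant being positive by strong convexity. -/
theorem contDiffOn_inv (hL : IsLocalFinsler L U) :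
    ∀ i j, ContDiffOn ℝ ∞ (fun z : Coord n × Coord n => (metricMatrix L z.1 z.2)⁻¹ i j)
      (slit U) := by
  intro i j
  simp only [Matrix.inv_def, Matrix.smul_apply, Ring.inverse_eq_inv', smul_eq_mul,
    Matrix.adjugate_apply]
  refine ContDiffOn.mul (ContDiffOn.inv (contDiffOn_det hL.contDiffOn_metricMatrix) ?_) ?_
  · exact fun z hz => (hL.posDef z.1 hz.1 z.2 hz.2).det_pos.ne'
  · refine contDiffOn_det fun k l => ?_
    simp only [Matrix.updateRow_apply]
    split_ifs
    · exact contDiffOn_const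
    · exact hL.contDiffOn_metricMatrix k l

theorem contDiffOn_sprayCoeff (hL : IsLocalFinsler L U) (i : Fin n) :
    ContDiffOn ℝ ∞ (fun z : Coord n × Coord n => sprayCoeff L i z.1 z.2) (slit U) := by
  unfold sprayCoeff
  have hy : ∀ k : Fin n, ContDiffOn ℝ ∞ (fun z : Coord n × Coord n => z.2 k) (slit U) :=
    fun k => by fun_prop
  refine contDiffOn_const.mul (ContDiffOn.sum fun l _ => (hL.contDiffOn_inv i l).mul
    (ContDiffOn.sub (ContDiffOn.sum fun k _ => ContDiffOn.mul ?_ (hy k)) ?_))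
  · exact contDiffOn_dX hL.isOpen_slit (contDiffOn_dY hL.isOpen_slit hL.contDiffOn_sq l) k
  · exact contDiffOn_dX hL.isOpen_slit hL.contDiffOn_sq l

theorem contDiffOn_sprayVec (hL : IsLocalFinsler L U) : ContDiffOn ℝ ∞ (sprayVec L) (slit U) := by
  rw [contDiffOn_euclidean]
  exact hL.contDiffOn_sprayCoeff

theorem hessian_symm (hL : IsLocalFinsler L U) {z : Coord n × Coord n} (hz : z ∈ slit U) (a b : Coord n × Coord n) :
    fderiv ℝ (fderiv ℝ (sq L)) z a b = fderiv ℝ (fderiv ℝ (sq L)) z b a :=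
  ((hL.contDiffOn_sq.contDiffAt (hL.isOpen_slit.mem_nhds hz)).isSymmSndFDerivAt
    two_le_smoothness) a b

theorem hessian_eq_sum (hL : IsLocalFinsler L U) {z : Coord n × Coord n} (hz : z ∈ slit U) (v w : Coord n) :
    fderiv ℝ (fderiv ℝ (sq L)) z (0, v) (0, w) =
      ∑ i, ∑ j, v i * w j * (2 * metricMatrix L z.1 z.2 i j) := by
  have h1 := map_eq_sum ((fderiv ℝ (fderiv ℝ (sq L)) z).comp
    (ContinuousLinearMap.inr ℝ (Coord n) (Coord n))).toLinearMap v
  have h2 := congrArg (fun T : (Coord n × Coord n) →L[ℝ] ℝ => T (0, w)) h1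
  simp only [ContinuousLinearMap.coe_coe, ContinuousLinearMap.comp_apply,
    ContinuousLinearMap.inr_apply, sum_apply, smul_apply] at h2
  rw [h2]
  refine Finset.sum_congr rfl fun i _ => ?_
  have h3 := map_eq_sum ((fderiv ℝ (fderiv ℝ (sq L)) z (0, EuclideanSpace.single i 1)).comp
    (ContinuousLinearMap.inr ℝ (Coord n) (Coord n))).toLinearMap w
  simp only [ContinuousLinearMap.coe_coe, ContinuousLinearMap.comp_apply,
    ContinuousLinearMap.inr_apply] at h3
  rw [h3, Finset.smul_sum]
  refine Finset.sum_congr rfl fun j _ => ?_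
  rw [hL.metricMatrix_eq hz]
  simp only [smul_eq_mul]
  ring

theorem hessian_pos (hL : IsLocalFinsler L U) {z : Coord n × Coord n} (hz : z ∈ slit U) {v : Coord n} (hv : v ≠ 0) :
    0 < fderiv ℝ (fderiv ℝ (sq L)) z (0, v) (0, v) := by
  have h := (hL.posDef z.1 hz.1 z.2 hz.2).dotProduct_mulVec_pos (x := v.ofLp)
    (fun h0 => hv (by ext i; exact congrFun h0 i))
  rw [hL.hessian_eq_sum hz]
  have e : ∑ i, ∑ j, v i * v j * (2 * metricMatrix L z.1 z.2 i j) =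
      2 * (star v.ofLp ⬝ᵥ (metricMatrix L z.1 z.2).mulVec v.ofLp) := by
    simp only [dotProduct, Matrix.mulVec, Finset.mul_sum, Pi.star_apply, star_trivial]
    exact Finset.sum_congr rfl fun i _ => Finset.sum_congr rfl fun j _ => by ring
  rw [e]
  linarith

/-- The Euler-Lagrange characterization of the spray. -/
theorem hessian_spray (hL : IsLocalFinsler L U) {z : Coord n × Coord n} (hz : z ∈ slit U) (w : Coord n) :
    fderiv ℝ (fderiv ℝ (sq L)) z (z.2, -sprayVec L z) (0, w) = fderiv ℝ (sq L) z (w, 0) := by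
  set H₂ := fderiv ℝ (fderiv ℝ (sq L)) z with hH₂
  set g := metricMatrix L z.1 z.2 with hg
  set a : Fin n → ℝ := fun l => (∑ k, dX k (dY l (fun x y => L x y ^ 2)) z.1 z.2 * z.2 k) -
    dX l (fun x y => L x y ^ 2) z.1 z.2 with ha
  have hdet : IsUnit g.det := (hL.posDef z.1 hz.1 z.2 hz.2).det_pos.ne'.isUnit
  have hG : (sprayVec L z).ofLp = (1 / 2 : ℝ) • g⁻¹.mulVec a := by
    funext i
    rfl
  -- Undoing g⁻¹ in the definition of the spray. As g is half the vertical Hessian of F², the factor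
  -- 1/2 disappears when this is read as an identity for that Hessian.
  have hgG : g.mulVec (sprayVec L z).ofLp = (1 / 2 : ℝ) • a := by
    rw [hG, Matrix.mulVec_smul, Matrix.mulVec_mulVec, Matrix.mul_nonsing_inv _ hdet,
      Matrix.one_mulVec]
  have hbasis : ∀ l, H₂ (z.2, -sprayVec L z) (0, EuclideanSpace.single l 1) =
      fderiv ℝ (sq L) z (EuclideanSpace.single l 1, 0) := by
    intro l
    have hl := congrFun hgG l
    have h1 : H₂ (z.2, -sprayVec L z) = H₂ (z.2, 0) - H₂ (0, sprayVec L z) := by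
      rw [← map_sub]
      simp
    have h2 : H₂ (0, sprayVec L z) (0, EuclideanSpace.single l 1) = a l := by
      rw [hL.hessian_symm hz, hL.hessian_eq_sum hz]
      have h3 : ∀ i, ∑ j, (EuclideanSpace.single l (1 : ℝ) : Coord n) i * sprayVec L z j *
          (2 * metricMatrix L z.1 z.2 i j) = if i = l then 2 * g.mulVec (sprayVec L z).ofLp i
            else 0 := by
        intro i
        split_ifs with h
        · subst h
          simp only [PiLp.single_apply, if_true, one_mul, Matrix.mulVec, dotProduct,
            Finset.mul_sum]
          exact Finset.sum_congr rfl fun j _ => by ring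
        · simp [h]
      rw [Finset.sum_congr rfl fun i _ => h3 i]
      simp only [Finset.sum_ite_eq', Finset.mem_univ, if_true]
      rw [hl, Pi.smul_apply, smul_eq_mul]
      ring
    have h4 : H₂ (z.2, 0) (0, EuclideanSpace.single l 1) =
        ∑ k, dX k (dY l (fun x y => L x y ^ 2)) z.1 z.2 * z.2 k := by
      have h5 := congrArg (fun T : (Coord n × Coord n) →L[ℝ] ℝ => T (0, EuclideanSpace.single l 1))
        (map_eq_sum (H₂.comp (ContinuousLinearMap.inl ℝ (Coord n) (Coord n))).toLinearMap z.2)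
      simp only [ContinuousLinearMap.coe_coe, ContinuousLinearMap.comp_apply,
        ContinuousLinearMap.inl_apply, sum_apply, smul_apply] at h5
      rw [h5]
      refine Finset.sum_congr rfl fun k _ => ?_
      rw [dX_dY_eq hL.isOpen_slit hL.contDiffOn_sq hz, smul_eq_mul, mul_comm]
      rfl
    rw [h1, sub_apply, h2, h4, ha, sub_sub_cancel,
      dX_eq (differentiableAt_of_contDiffOn hL.isOpen_slit hL.contDiffOn_sq hz)]
    rfl
  have h1 := map_eq_sum ((H₂ (z.2, -sprayVec L z)).comp
    (ContinuousLinearMap.inr ℝ (Coord n) (Coord n))).toLinearMap w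
  have h2 := map_eq_sum ((fderiv ℝ (sq L) z).comp
    (ContinuousLinearMap.inl ℝ (Coord n) (Coord n))).toLinearMap w
  simp only [ContinuousLinearMap.coe_coe, ContinuousLinearMap.comp_apply,
    ContinuousLinearMap.inr_apply, ContinuousLinearMap.inl_apply] at h1 h2
  rw [h1, h2]
  exact Finset.sum_congr rfl fun l _ => by rw [hbasis]

/-- Two solutions of the Euler-Lagrange identity differ by a vertical vector on which the positive
definite vertical Hessian vanishes. Both the homogeneity and the transformation law of the spray
rest on this uniqueness. -/
theorem sprayVec_eq_of_hessian (hL : IsLocalFinsler L U) {z : Coord n × Coord n} (hz : z ∈ slit U) {η : Coord n}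
    (h : ∀ w, fderiv ℝ (fderiv ℝ (sq L)) z (z.2, -η) (0, w) = fderiv ℝ (sq L) z (w, 0)) :
    sprayVec L z = η := by
  by_contra hne
  refine (hL.hessian_pos hz (sub_ne_zero.2 hne)).ne' ?_
  have h1 : ((0 : Coord n), sprayVec L z - η) = (z.2, -η) - (z.2, -sprayVec L z) := by
    rw [Prod.mk_sub_mk, sub_self, neg_sub_neg]
  have h2 := h (sprayVec L z - η)
  rw [← hL.hessian_spray hz, ← sub_eq_zero, ← sub_apply, ← map_sub, ← h1] at h2
  exact h2

end IsLocalFinsler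
end Coordinates

/-! ### Consequences of homogeneity: Euler identities, positivity and scaling of the spray. -/

section Homogeneity
variable {n : ℕ}

namespace IsLocalFinsler
variable {L : Coord n → Coord n → ℝ} {U : Set (Coord n)}

theorem sq_smul (hL : IsLocalFinsler L U) {c : ℝ} (hc : 0 < c) (z : Coord n × Coord n) :
    sq L (z.1, c • z.2) = c ^ 2 * sq L z := by
  simp only [sq]
  rw [hL.homogeneous _ _ c hc]
  ring

theorem smul_mem_slit {c : ℝ} (hc : 0 < c) {z : Coord n × Coord n} (hz : z ∈ slit U) :
    (z.1, c • z.2) ∈ slit U := ⟨hz.1, smul_ne_zero hc.ne' hz.2⟩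

theorem differentiableAt_sq (hL : IsLocalFinsler L U) {z : Coord n × Coord n} (hz : z ∈ slit U) :
    DifferentiableAt ℝ (sq L) z :=
  differentiableAt_of_contDiffOn hL.isOpen_slit hL.contDiffOn_sq hz

theorem differentiableAt_fderiv_sq (hL : IsLocalFinsler L U) {z : Coord n × Coord n}
    (hz : z ∈ slit U) : DifferentiableAt ℝ (fderiv ℝ (sq L)) z :=
  differentiableAt_of_contDiffOn hL.isOpen_slit
    (hL.contDiffOn_sq.fderiv_of_isOpen hL.isOpen_slit (m := ∞) le_rfl) hz

theorem fderiv_sq_smul (hL : IsLocalFinsler L U) {k : ℝ} (hk : 0 < k) {z : Coord n × Coord n}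
    (hz : z ∈ slit U) (a : Coord n × Coord n) :
    fderiv ℝ (sq L) (z.1, k • z.2) (a.1, k • a.2) = k ^ 2 * fderiv ℝ (sq L) z a := by
  obtain ⟨c, hc0, hc⟩ := exists_curve z a
  have h1 := hasDerivAt_comp_curve (hL.differentiableAt_sq (smul_mem_slit hk hz)) (by simp [hc0])
    ((hasDerivAt_fst hc).prodMk ((hasDerivAt_snd hc).const_smul k))
  have h2 := (hasDerivAt_comp_curve (hL.differentiableAt_sq hz) hc0 hc).const_mul (k ^ 2)
  exact h1.unique (h2.congr_of_eventuallyEq (.of_forall fun t => hL.sq_smul hk (c t)))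

theorem hessian_smul (hL : IsLocalFinsler L U) {k : ℝ} (hk : 0 < k) {z : Coord n × Coord n}
    (hz : z ∈ slit U) (a b : Coord n × Coord n) :
    fderiv ℝ (fderiv ℝ (sq L)) (z.1, k • z.2) (a.1, k • a.2) (b.1, k • b.2) =
      k ^ 2 * fderiv ℝ (fderiv ℝ (sq L)) z a b := by
  obtain ⟨c, hc0, hc⟩ := exists_curve z a
  have h1 := (hasDerivAt_comp_curve (hL.differentiableAt_fderiv_sq (smul_mem_slit hk hz))
    (by simp [hc0]) ((hasDerivAt_fst hc).prodMk ((hasDerivAt_snd hc).const_smul k))).clm_apply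
    (hasDerivAt_const (0 : ℝ) (b.1, k • b.2))
  have h2 := ((hasDerivAt_comp_curve (hL.differentiableAt_fderiv_sq hz) hc0 hc).clm_apply
    (hasDerivAt_const (0 : ℝ) b)).const_mul (k ^ 2)
  have h3 := h1.unique (h2.congr_of_eventuallyEq
    ((eventually_mem_curve hL.isOpen_slit (by rwa [hc0]) hc).mono fun t ht =>
      hL.fderiv_sq_smul hk ht b))
  simpa using h3

/-- The derivative at t = 0 of F²(x, (1 + t)y) = (1 + t)² F²(x, y). -/
theorem euler (hL : IsLocalFinsler L U) {z : Coord n × Coord n} (hz : z ∈ slit U) :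
    fderiv ℝ (sq L) z (0, z.2) = 2 * sq L z := by
  have hc : HasDerivAt (fun t : ℝ => (z.1, (1 + t) • z.2)) (0, z.2) 0 := by
    refine (hasDerivAt_const (0 : ℝ) z.1).prodMk ?_
    simpa using ((hasDerivAt_id (0 : ℝ)).const_add 1).smul_const z.2
  have h1 := hasDerivAt_comp_curve (hL.differentiableAt_sq hz) (by simp) hc
  have h2 := (((hasDerivAt_id (0 : ℝ)).const_add 1).pow 2).mul_const (sq L z)
  have h3 : ∀ᶠ t : ℝ in 𝓝 0, 0 < 1 + t :=
    (eventually_gt_nhds (show (-1 : ℝ) < 0 by norm_num)).mono fun t ht => by linarith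
  have h4 := h1.unique (h2.congr_of_eventuallyEq (h3.mono fun t ht => hL.sq_smul ht z))
  simpa using h4

/-- Euler's identity differentiated in the direction a, which moves the vector y as well. -/
theorem hessian_euler (hL : IsLocalFinsler L U) {z : Coord n × Coord n} (hz : z ∈ slit U)
    (a : Coord n × Coord n) :
    fderiv ℝ (fderiv ℝ (sq L)) z a (0, z.2) + fderiv ℝ (sq L) z (0, a.2) =
      2 * fderiv ℝ (sq L) z a := by
  obtain ⟨c, hc0, hc⟩ := exists_curve z a
  have h1 := (hasDerivAt_comp_curve (hL.differentiableAt_fderiv_sq hz) hc0 hc).clm_apply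
    ((hasDerivAt_const (0 : ℝ) (0 : Coord n)).prodMk (hasDerivAt_snd hc))
  have h2 := (hasDerivAt_comp_curve (hL.differentiableAt_sq hz) hc0 hc).const_mul 2
  have h3 := h1.unique (h2.congr_of_eventuallyEq
    ((eventually_mem_curve hL.isOpen_slit (by rwa [hc0]) hc).mono fun t ht => hL.euler ht))
  simpa [hc0] using h3

/-- `F` is constant along the integral curves of the spray. -/
theorem fderiv_sq_spray (hL : IsLocalFinsler L U) {z : Coord n × Coord n} (hz : z ∈ slit U) :
    fderiv ℝ (sq L) z (z.2, -sprayVec L z) = 0 := by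
  have h1 := hL.hessian_euler hz (z.2, -sprayVec L z)
  rw [hL.hessian_spray hz, ← map_add, Prod.mk_add_mk, add_zero, zero_add] at h1
  linarith

/-- The two Euler identities make the vertical Hessian at (y, y) equal to 2F², so positivity of F
off the zero section follows from strong convexity. -/
theorem sq_pos (hL : IsLocalFinsler L U) {z : Coord n × Coord n} (hz : z ∈ slit U) :
    0 < sq L z := by
  have h1 := hL.hessian_euler hz (0, z.2)
  have h2 := hL.hessian_pos hz hz.2
  have h3 := hL.euler hz
  dsimp only at h1
  linarith

/-- The vector k²G satisfies the Euler-Lagrange identity at (x, ky), by the scaling of the first and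
second derivatives of F². -/
theorem sprayVec_smul (hL : IsLocalFinsler L U) {k : ℝ} (hk : 0 < k) {z : Coord n × Coord n}
    (hz : z ∈ slit U) : sprayVec L (z.1, k • z.2) = k ^ 2 • sprayVec L z := by
  refine hL.sprayVec_eq_of_hessian (smul_mem_slit hk hz) fun w => ?_
  have h1 := hL.hessian_smul hk hz (z.2, -sprayVec L z) (0, k⁻¹ • w)
  have h2 := hL.fderiv_sq_smul hk hz (w, 0)
  have h3 : (k • z.2, -(k ^ 2 • sprayVec L z)) = k • (z.2, k • -sprayVec L z) := by
    rw [Prod.smul_mk, smul_neg, smul_neg, smul_smul, pow_two]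
  have h4 : fderiv ℝ (sq L) z (k⁻¹ • w, 0) = k⁻¹ * fderiv ℝ (sq L) z (w, 0) := by
    rw [← smul_eq_mul, ← map_smul, Prod.smul_mk, smul_zero]
  rw [smul_inv_smul₀ hk.ne', hL.hessian_spray hz, h4] at h1
  rw [smul_zero] at h2
  dsimp only at h1 h2 ⊢
  rw [h3, map_smul, smul_apply, h1, h2, smul_eq_mul]
  field_simp

end IsLocalFinsler
end Homogeneity

/-! ### Transformation law of the spray under a change of coordinates. -/

section Transition
variable {n : ℕ}

/-- `φ` is a change of coordinates on `D` that transforms `L` into `L'`. -/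
structure IsTransition (L : Coord n → Coord n → ℝ) (U : Set (Coord n))
    (L' : Coord n → Coord n → ℝ) (U' : Set (Coord n)) (φ : Coord n → Coord n)
    (D : Set (Coord n)) : Prop where
  isOpen : IsOpen D
  subset : D ⊆ U
  smooth : ContDiffOn ℝ ∞ φ D
  mapsTo : ∀ x ∈ D, φ x ∈ U'
  bijective : ∀ x ∈ D, Function.Bijective (fderiv ℝ φ x)
  eq : ∀ x ∈ D, ∀ y, L' (φ x) (fderiv ℝ φ x y) = L x y

theorem slit_mono {D U : Set (Coord n)} (h : D ⊆ U) : slit D ⊆ slit U := fun _ hz => ⟨h hz.1, hz.2⟩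

namespace IsTransition
variable {L L' : Coord n → Coord n → ℝ} {U U' D : Set (Coord n)} {φ : Coord n → Coord n}

theorem tangentLift_mem (hT : IsTransition L U L' U' φ D) {z : Coord n × Coord n}
    (hz : z ∈ slit D) : tangentLift φ z ∈ slit U' :=
  ⟨hT.mapsTo _ hz.1, fun h => hz.2 ((hT.bijective _ hz.1).1 (by rw [map_zero]; exact h))⟩

theorem contDiffAt (hT : IsTransition L U L' U' φ D) {z : Coord n × Coord n}
    (hz : z ∈ slit D) : ContDiffAt ℝ ∞ φ z.1 :=
  hT.smooth.contDiffAt (hT.isOpen.mem_nhds hz.1)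

theorem fderiv_comp (hT : IsTransition L U L' U' φ D) (hU : IsOpen U) (hU' : IsOpen U')
    {f f' : Coord n × Coord n → ℝ} (hf : ContDiffOn ℝ ∞ f (slit U))
    (hf' : ContDiffOn ℝ ∞ f' (slit U'))
    (h : ∀ z ∈ slit D, f' (tangentLift φ z) = f z) {z : Coord n × Coord n} (hz : z ∈ slit D)
    (a : Coord n × Coord n) :
    fderiv ℝ f' (tangentLift φ z)
      (fderiv ℝ φ z.1 a.1, fderiv ℝ (fderiv ℝ φ) z.1 a.1 z.2 + fderiv ℝ φ z.1 a.2) =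
      fderiv ℝ f z a := by
  obtain ⟨c, hc0, hc⟩ := exists_curve z a
  have h1 := hasDerivAt_comp_curve
    (differentiableAt_of_contDiffOn (Finsler.isOpen_slit hU') hf' (hT.tangentLift_mem hz))
    (by rw [hc0]) (hasDerivAt_tangentLift ((hT.contDiffAt hz).of_le (by norm_cast)) hc0 hc)
  have h2 := hasDerivAt_comp_curve (differentiableAt_of_contDiffOn (Finsler.isOpen_slit hU) hf
    (slit_mono hT.subset hz)) hc0 hc
  exact h1.unique (h2.congr_of_eventuallyEq
    ((eventually_mem_curve (isOpen_slit hT.isOpen) (by rwa [hc0]) hc).mono fun t ht => h _ ht))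

/-- The first-order chain rule for vertical vectors (0, u), differentiated in the direction a. The
extra first-derivative term arises because the image of (0, u) varies with the base point. -/
theorem hessian_comp (hT : IsTransition L U L' U' φ D) (hU : IsOpen U) (hU' : IsOpen U')
    {f f' : Coord n × Coord n → ℝ} (hf : ContDiffOn ℝ ∞ f (slit U))
    (hf' : ContDiffOn ℝ ∞ f' (slit U'))
    (h : ∀ z ∈ slit D, f' (tangentLift φ z) = f z) {z : Coord n × Coord n} (hz : z ∈ slit D)
    (a : Coord n × Coord n) (u : Coord n) :
    fderiv ℝ (fderiv ℝ f') (tangentLift φ z)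
        (fderiv ℝ φ z.1 a.1, fderiv ℝ (fderiv ℝ φ) z.1 a.1 z.2 + fderiv ℝ φ z.1 a.2)
        (0, fderiv ℝ φ z.1 u) +
      fderiv ℝ f' (tangentLift φ z) (0, fderiv ℝ (fderiv ℝ φ) z.1 a.1 u) =
      fderiv ℝ (fderiv ℝ f) z a (0, u) := by
  obtain ⟨c, hc0, hc⟩ := exists_curve z a
  have hW := Finsler.isOpen_slit hU
  have hW' := Finsler.isOpen_slit hU'
  have h1 := (hasDerivAt_comp_curve (differentiableAt_of_contDiffOn hW'
    (hf'.fderiv_of_isOpen hW' (m := ∞) le_rfl) (hT.tangentLift_mem hz))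
    (by rw [hc0]) (hasDerivAt_tangentLift ((hT.contDiffAt hz).of_le (by norm_cast)) hc0
      hc)).clm_apply ((hasDerivAt_const (0 : ℝ) (0 : Coord n)).prodMk
        ((hasDerivAt_comp_curve (((hT.contDiffAt hz).fderiv_right (m := 1)
          (by norm_cast)).differentiableAt one_ne_zero) (by rw [hc0]) (hasDerivAt_fst hc)).clm_apply
            (hasDerivAt_const (0 : ℝ) u)))
  have h2 := (hasDerivAt_comp_curve (differentiableAt_of_contDiffOn hW
    (hf.fderiv_of_isOpen hW (m := ∞) le_rfl) (slit_mono hT.subset hz)) hc0 hc).clm_apply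
      (hasDerivAt_const (0 : ℝ) ((0 : Coord n), u))
  have h3 := h1.unique (h2.congr_of_eventuallyEq
    ((eventually_mem_curve (isOpen_slit hT.isOpen) (by rwa [hc0]) hc).mono fun t ht => by
      have := hT.fderiv_comp hU hU' hf hf' h ht (0, u)
      simp only [map_zero, zero_apply, zero_add] at this
      exact this))
  simpa [hc0] using h3

/-- The transformed vector satisfies the Euler-Lagrange identity of L': the terms in D²φ from the
first and second derivatives of F² agree by symmetry and cancel. -/
theorem sprayVec_tangentLift (hT : IsTransition L U L' U' φ D) (hL : IsLocalFinsler L U)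
    (hL' : IsLocalFinsler L' U') {z : Coord n × Coord n} (hz : z ∈ slit D) :
    sprayVec L' (tangentLift φ z) =
      fderiv ℝ φ z.1 (sprayVec L z) - fderiv ℝ (fderiv ℝ φ) z.1 z.2 z.2 := by
  have hsq : ∀ z ∈ slit D, sq L' (tangentLift φ z) = sq L z := fun z hz => by
    simp only [sq, tangentLift, hT.eq _ hz.1]
  refine hL'.sprayVec_eq_of_hessian (hT.tangentLift_mem hz) fun w => ?_
  obtain ⟨u, rfl⟩ := (hT.bijective _ hz.1).2 w
  have h1 := hT.hessian_comp hL.isOpen hL'.isOpen hL.contDiffOn_sq hL'.contDiffOn_sq hsq hz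
    (z.2, -sprayVec L z) u
  have h2 := hT.fderiv_comp hL.isOpen hL'.isOpen hL.contDiffOn_sq hL'.contDiffOn_sq hsq hz (u, 0)
  have hB : fderiv ℝ (fderiv ℝ φ) z.1 z.2 u = fderiv ℝ (fderiv ℝ φ) z.1 u z.2 :=
    ((hT.contDiffAt hz).isSymmSndFDerivAt two_le_smoothness) _ _
  rw [hL.hessian_spray (slit_mono hT.subset hz), ← h2, hB] at h1
  simp only [map_zero, add_zero, map_neg] at h1
  have h3 : (fderiv ℝ φ z.1 u, fderiv ℝ (fderiv ℝ φ) z.1 u z.2) =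
      (fderiv ℝ φ z.1 u, 0) + (0, fderiv ℝ (fderiv ℝ φ) z.1 u z.2) := by simp
  rw [h3, map_add, add_left_inj] at h1
  rw [← h1, neg_sub, sub_eq_add_neg]
  rfl

end IsTransition
end Transition

/-! ### The Ricci tensor as the vertical Hessian of a trace. -/

section Ricci
variable {n : ℕ}

theorem curvatureOp_add (G : Coord n × Coord n → Coord n) (z : Coord n × Coord n)
    (u v : Coord n) : curvatureOp G z (u + v) = curvatureOp G z u + curvatureOp G z v := by
  have h1 : ((u + v, 0) : Coord n × Coord n) = (u, 0) + (v, 0) := by simp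
  have h2 : ∀ u v : Coord n, ((0, u + v) : Coord n × Coord n) = (0, u) + (0, v) := by simp
  simp only [curvatureOp, h1, h2, map_add]
  module

theorem curvatureOp_smul (G : Coord n × Coord n → Coord n) (z : Coord n × Coord n)
    (c : ℝ) (u : Coord n) : curvatureOp G z (c • u) = c • curvatureOp G z u := by
  have h1 : ((c • u, 0) : Coord n × Coord n) = c • (u, 0) := by simp
  have h2 : ∀ u : Coord n, ((0, c • u) : Coord n × Coord n) = c • (0, u) := by simp
  simp only [curvatureOp, h1, h2, map_smul]
  module

/-- `curvatureOp` as a linear map. -/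
def curvatureLin (G : Coord n × Coord n → Coord n) (z : Coord n × Coord n) :
    Coord n →ₗ[ℝ] Coord n where
  toFun := curvatureOp G z
  map_add' := curvatureOp_add G z
  map_smul' := curvatureOp_smul G z

theorem contDiffOn_curvatureOp {G : Coord n × Coord n → Coord n} {W : Set (Coord n × Coord n)}
    (hW : IsOpen W) (hG : ContDiffOn ℝ ∞ G W) (η : Coord n) :
    ContDiffOn ℝ ∞ (fun z => curvatureOp G z η) W := by
  have h1 : ContDiffOn ℝ ∞ (fderiv ℝ G) W := hG.fderiv_of_isOpen hW (m := ∞) le_rfl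
  have h2 : ContDiffOn ℝ ∞ (fderiv ℝ (fderiv ℝ G)) W := h1.fderiv_of_isOpen hW (m := ∞) le_rfl
  have h3 : ContDiffOn ℝ ∞ (fun z : Coord n × Coord n => (z.2, -G z)) W :=
    contDiff_snd.contDiffOn.prodMk hG.neg
  have h4 : ContDiffOn ℝ ∞ (fun z => fderiv ℝ G z (η, 0)) W := h1.clm_apply contDiffOn_const
  have h5 : ContDiffOn ℝ ∞ (fun z => fderiv ℝ (fderiv ℝ G) z (z.2, -G z)) W := h2.clm_apply h3
  have h6 : ContDiffOn ℝ ∞ (fun z => fderiv ℝ (fderiv ℝ G) z (z.2, -G z) (0, η)) W :=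
    h5.clm_apply contDiffOn_const
  have h7 : ContDiffOn ℝ ∞ (fun z => ((0 : Coord n), fderiv ℝ G z (0, η))) W :=
    contDiffOn_const.prodMk (h1.clm_apply contDiffOn_const)
  have h8 : ContDiffOn ℝ ∞ (fun z => fderiv ℝ G z (0, fderiv ℝ G z (0, η))) W := h1.clm_apply h7
  unfold curvatureOp
  exact ((h4.const_smul 2).sub h6).sub (h8.const_smul (1 / 2))

/-- `F² Ric` as a function on the product. -/
def ricciFun (L : Coord n → Coord n → ℝ) (z : Coord n × Coord n) : ℝ :=
  L z.1 z.2 ^ 2 * ricciScalar L z.1 z.2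

theorem fderiv_coord {G : Coord n × Coord n → Coord n} {z : Coord n × Coord n}
    (hG : DifferentiableAt ℝ G z) (i : Fin n) (a : Coord n × Coord n) :
    fderiv ℝ (fun z => G z i) z a = fderiv ℝ G z a i := by
  have h := ((EuclideanSpace.proj (𝕜 := ℝ) i).hasFDerivAt (x := G z)).comp z hG.hasFDerivAt
  exact congrArg (fun T => T a) h.fderiv

namespace IsLocalFinsler
variable {L : Coord n → Coord n → ℝ} {U : Set (Coord n)}

theorem fderiv_fderiv_sprayCoeff (hL : IsLocalFinsler L U) {z : Coord n × Coord n}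
    (hz : z ∈ slit U) (i : Fin n) (a b : Coord n × Coord n) :
    fderiv ℝ (fderiv ℝ (fun z : Coord n × Coord n => sprayCoeff L i z.1 z.2)) z a b =
      fderiv ℝ (fderiv ℝ (sprayVec L)) z a b i := by
  rw [← fderiv_fderiv_apply_const hL.isOpen_slit (hL.contDiffOn_sprayCoeff i) hz,
    ← fderiv_fderiv_apply_const hL.isOpen_slit hL.contDiffOn_sprayVec hz,
    ← fderiv_coord (differentiableAt_of_contDiffOn hL.isOpen_slit
      (contDiffOn_fderiv_apply hL.isOpen_slit hL.contDiffOn_sprayVec b) hz)]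
  congr 1
  exact Filter.EventuallyEq.fderiv_eq (Filter.eventuallyEq_of_mem (hL.isOpen_slit.mem_nhds hz)
    fun x hx => fderiv_coord (G := sprayVec L)
      (differentiableAt_of_contDiffOn hL.isOpen_slit hL.contDiffOn_sprayVec hx) i b)

/-- The index sums of the coordinate formula are the linear maps G_y and D²G expanded in the
standard basis. -/
theorem riemannCurvature_eq (hL : IsLocalFinsler L U) {z : Coord n × Coord n}
    (hz : z ∈ slit U) (i k : Fin n) :
    riemannCurvature L i k z.1 z.2 =
      curvatureOp (sprayVec L) z (EuclideanSpace.single k 1) i / (2 * sq L z) := by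
  have hd := differentiableAt_of_contDiffOn hL.isOpen_slit hL.contDiffOn_sprayVec hz
  have hX : ∀ i k, dX k (sprayCoeff L i) z.1 z.2 =
      fderiv ℝ (sprayVec L) z (EuclideanSpace.single k 1, 0) i := fun i k => by
    rw [dX_eq (differentiableAt_of_contDiffOn hL.isOpen_slit (hL.contDiffOn_sprayCoeff i) hz),
      ← fderiv_coord hd]
    rfl
  have hY : ∀ i k, dY k (sprayCoeff L i) z.1 z.2 =
      fderiv ℝ (sprayVec L) z (0, EuclideanSpace.single k 1) i := fun i k => by
    rw [dY_eq (differentiableAt_of_contDiffOn hL.isOpen_slit (hL.contDiffOn_sprayCoeff i) hz),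
      ← fderiv_coord hd]
    rfl
  have hXY : ∀ j, dX j (dY k (sprayCoeff L i)) z.1 z.2 =
      fderiv ℝ (fderiv ℝ (sprayVec L)) z (EuclideanSpace.single j 1, 0)
        (0, EuclideanSpace.single k 1) i := fun j => by
    rw [dX_dY_eq hL.isOpen_slit (hL.contDiffOn_sprayCoeff i) hz,
      hL.fderiv_fderiv_sprayCoeff hz]
  have hYY : ∀ j, dY j (dY k (sprayCoeff L i)) z.1 z.2 =
      fderiv ℝ (fderiv ℝ (sprayVec L)) z (0, EuclideanSpace.single j 1)
        (0, EuclideanSpace.single k 1) i := fun j => by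
    rw [dY_dY_eq hL.isOpen_slit (hL.contDiffOn_sprayCoeff i) hz,
      hL.fderiv_fderiv_sprayCoeff hz]
  set T₂ := fderiv ℝ (fderiv ℝ (sprayVec L)) z with hT₂
  set T := fderiv ℝ (sprayVec L) z with hT
  have e1 : ∑ j, dY j (sprayCoeff L i) z.1 z.2 * dY k (sprayCoeff L j) z.1 z.2 =
      T (0, T (0, EuclideanSpace.single k 1)) i := by
    have h1 := congrArg (fun v : Coord n => v i) (map_eq_sum (T.comp
      (ContinuousLinearMap.inr ℝ (Coord n) (Coord n))).toLinearMap
      (T (0, EuclideanSpace.single k 1)))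
    simp only [ContinuousLinearMap.coe_coe, ContinuousLinearMap.comp_apply,
      ContinuousLinearMap.inr_apply, PiLp.smul_apply, WithLp.ofLp_sum, Finset.sum_apply,
      smul_eq_mul] at h1
    rw [h1]
    exact Finset.sum_congr rfl fun j _ => by rw [hY, hY, mul_comm]
  have e2 : ∑ j, z.2 j * dX j (dY k (sprayCoeff L i)) z.1 z.2 =
      T₂ (z.2, 0) (0, EuclideanSpace.single k 1) i := by
    have h1 := congrArg (fun S : (Coord n × Coord n) →L[ℝ] Coord n =>
      S (0, EuclideanSpace.single k 1) i) (map_eq_sum (T₂.comp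
      (ContinuousLinearMap.inl ℝ (Coord n) (Coord n))).toLinearMap z.2)
    simp only [ContinuousLinearMap.coe_coe, ContinuousLinearMap.comp_apply, sum_apply, smul_apply,
      ContinuousLinearMap.inl_apply, PiLp.smul_apply, WithLp.ofLp_sum, Finset.sum_apply,
      smul_eq_mul] at h1
    rw [h1]
    exact Finset.sum_congr rfl fun j _ => by rw [hXY]
  have e3 : ∑ j, sprayCoeff L j z.1 z.2 * dY j (dY k (sprayCoeff L i)) z.1 z.2 =
      T₂ (0, sprayVec L z) (0, EuclideanSpace.single k 1) i := by
    have h1 := congrArg (fun S : (Coord n × Coord n) →L[ℝ] Coord n =>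
      S (0, EuclideanSpace.single k 1) i) (map_eq_sum (T₂.comp
      (ContinuousLinearMap.inr ℝ (Coord n) (Coord n))).toLinearMap (sprayVec L z))
    simp only [ContinuousLinearMap.coe_coe, ContinuousLinearMap.comp_apply, sum_apply, smul_apply,
      ContinuousLinearMap.inr_apply, PiLp.smul_apply, WithLp.ofLp_sum, Finset.sum_apply,
      smul_eq_mul] at h1
    rw [h1]
    exact Finset.sum_congr rfl fun j _ => by rw [hYY]; rfl
  have e4 : T₂ (z.2, -sprayVec L z) = T₂ (z.2, 0) - T₂ (0, sprayVec L z) := by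
    rw [← map_sub]
    simp
  rw [riemannCurvature, e1, e2, e3, hX, curvatureOp, ← hT₂, ← hT, e4]
  simp only [PiLp.sub_apply, PiLp.smul_apply, smul_eq_mul, sub_apply, sq]
  congr 1
  ring

theorem ricciFun_eq (hL : IsLocalFinsler L U) {z : Coord n × Coord n} (hz : z ∈ slit U) :
    ricciFun L z =
      ∑ i, 1 / 2 * curvatureOp (sprayVec L) z (EuclideanSpace.single i 1) i := by
  have h : sq L z ≠ 0 := (hL.sq_pos hz).ne'
  rw [ricciFun, ricciScalar, Finset.mul_sum]
  refine Finset.sum_congr rfl fun i _ => ?_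
  rw [hL.riemannCurvature_eq hz]
  change sq L z * (_ / (2 * sq L z)) = _
  field_simp

theorem ricciFun_eq_trace (hL : IsLocalFinsler L U) {z : Coord n × Coord n} (hz : z ∈ slit U) :
    ricciFun L z = 1 / 2 * LinearMap.trace ℝ (Coord n) (curvatureLin (sprayVec L) z) := by
  rw [hL.ricciFun_eq hz, LinearMap.trace_eq_sum_inner _ (EuclideanSpace.basisFun (Fin n) ℝ),
    Finset.mul_sum]
  refine Finset.sum_congr rfl fun i _ => ?_
  rw [EuclideanSpace.basisFun_apply, EuclideanSpace.inner_single_left]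
  simp [curvatureLin]

theorem contDiffOn_ricciFun (hL : IsLocalFinsler L U) :
    ContDiffOn ℝ ∞ (ricciFun L) (slit U) := by
  refine ContDiffOn.congr (ContDiffOn.sum fun i _ => contDiffOn_const.mul ?_)
    fun z hz => hL.ricciFun_eq hz
  exact (contDiffOn_euclidean.1 (contDiffOn_curvatureOp hL.isOpen_slit hL.contDiffOn_sprayVec _)) i

theorem ricciTensor_eq (hL : IsLocalFinsler L U) {z : Coord n × Coord n} (hz : z ∈ slit U)
    (j k : Fin n) : ricciTensor L j k z.1 z.2 = 1 / 2 * fderiv ℝ (fderiv ℝ (ricciFun L)) z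
      (0, EuclideanSpace.single j 1) (0, EuclideanSpace.single k 1) := by
  rw [ricciTensor, dY_dY_eq hL.isOpen_slit hL.contDiffOn_ricciFun hz]
  rfl

theorem contDiffOn_ricciTensor (hL : IsLocalFinsler L U) (j k : Fin n) :
    ContDiffOn ℝ ∞ (fun z : Coord n × Coord n => ricciTensor L j k z.1 z.2) (slit U) := by
  unfold ricciTensor
  exact contDiffOn_const.mul (contDiffOn_dY hL.isOpen_slit
    (contDiffOn_dY hL.isOpen_slit hL.contDiffOn_ricciFun k) j)

theorem ricciTensor_sum_eq (hL : IsLocalFinsler L U) {z : Coord n × Coord n} (hz : z ∈ slit U)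
    (v : Coord n) : ∑ j, ∑ k, ricciTensor L j k z.1 z.2 * v j * v k =
      1 / 2 * fderiv ℝ (fderiv ℝ (ricciFun L)) z (0, v) (0, v) := by
  set H₂ := fderiv ℝ (fderiv ℝ (ricciFun L)) z with hH₂
  have h1 := congrArg (fun T : (Coord n × Coord n) →L[ℝ] ℝ => T (0, v)) (map_eq_sum
    (H₂.comp (ContinuousLinearMap.inr ℝ (Coord n) (Coord n))).toLinearMap v)
  simp only [ContinuousLinearMap.coe_coe, ContinuousLinearMap.comp_apply,
    ContinuousLinearMap.inr_apply, sum_apply, smul_apply, smul_eq_mul] at h1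
  rw [h1, Finset.mul_sum]
  refine Finset.sum_congr rfl fun j _ => ?_
  have h2 := map_eq_sum ((H₂ (0, EuclideanSpace.single j 1)).comp
    (ContinuousLinearMap.inr ℝ (Coord n) (Coord n))).toLinearMap v
  simp only [ContinuousLinearMap.coe_coe, ContinuousLinearMap.comp_apply,
    ContinuousLinearMap.inr_apply, smul_eq_mul] at h2
  rw [h2, Finset.mul_sum, Finset.mul_sum]
  refine Finset.sum_congr rfl fun k _ => ?_
  rw [hL.ricciTensor_eq hz]
  ring

end IsLocalFinsler

namespace IsTransition
variable {L L' : Coord n → Coord n → ℝ} {U U' D : Set (Coord n)} {φ : Coord n → Coord n}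

/-- The curvature operators in the two charts are conjugate by Dφ, hence have the same trace. -/
theorem ricciFun_tangentLift (hT : IsTransition L U L' U' φ D) (hL : IsLocalFinsler L U)
    (hL' : IsLocalFinsler L' U') {z : Coord n × Coord n} (hz : z ∈ slit D) :
    ricciFun L' (tangentLift φ z) = ricciFun L z := by
  rw [hL.ricciFun_eq_trace (slit_mono hT.subset hz), hL'.ricciFun_eq_trace (hT.tangentLift_mem hz)]
  set e := LinearEquiv.ofBijective (fderiv ℝ φ z.1).toLinearMap (hT.bijective _ hz.1) with he
  rw [← LinearMap.trace_conj' (curvatureLin (sprayVec L) z) e]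
  congr 2
  refine LinearMap.ext fun w => ?_
  obtain ⟨u, rfl⟩ := e.surjective w
  rw [LinearEquiv.conj_apply_apply, e.symm_apply_apply]
  exact curvatureOp_tangentLift hT.isOpen hT.smooth (isOpen_slit hT.isOpen) (fun _ h => h.1)
    hL'.isOpen_slit (fun _ h => hT.tangentLift_mem h)
    (hL.contDiffOn_sprayVec.mono (slit_mono hT.subset)) hL'.contDiffOn_sprayVec
    (fun _ h => hT.sprayVec_tangentLift hL hL' h) hz u

/-- Both sides are vertical Hessians of the invariant function F² Ric. On a fibre the tangent lift
is linear, so no term in D²φ appears. -/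
theorem ricciTensor_sum_tangentLift (hT : IsTransition L U L' U' φ D) (hL : IsLocalFinsler L U)
    (hL' : IsLocalFinsler L' U') {z : Coord n × Coord n} (hz : z ∈ slit D) (v : Coord n) :
    ∑ j, ∑ k, ricciTensor L' j k (tangentLift φ z).1 (tangentLift φ z).2 *
      fderiv ℝ φ z.1 v j * fderiv ℝ φ z.1 v k =
      ∑ j, ∑ k, ricciTensor L j k z.1 z.2 * v j * v k := by
  rw [hL.ricciTensor_sum_eq (slit_mono hT.subset hz),
    hL'.ricciTensor_sum_eq (hT.tangentLift_mem hz)]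
  have h := hT.hessian_comp hL.isOpen hL'.isOpen hL.contDiffOn_ricciFun hL'.contDiffOn_ricciFun
    (fun z hz => hT.ricciFun_tangentLift hL hL' hz) hz (0, v) v
  simp only [map_zero, zero_apply, zero_add, Prod.mk_zero_zero, add_zero] at h
  rw [h]

end IsTransition
end Ricci

/-! ### Geodesics on M and the conclusion. -/

namespace FinslerStructure
section Geodesics
variable {n : ℕ} {M : Type*} [TopologicalSpace M] [ChartedSpace (Coord n) M]
  [IsManifold (𝓡 n) ∞ M] (F : FinslerStructure n M)

theorem isLocalFinsler (p : M) : IsLocalFinsler (F.inChart p) (extChartAt (𝓡 n) p).target where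
  isOpen := isOpen_extChartAt_target p
  smooth := F.contDiffOn_inChart p
  homogeneous := fun x y _ hc => F.inChart_smul p x y hc
  posDef := fun x hx y hy => F.strongly_convex p x y hx hy

theorem isTransition (p p' : M) :
    IsTransition (F.inChart p) (extChartAt (𝓡 n) p).target (F.inChart p')
      (extChartAt (𝓡 n) p').target (transition n p p') (overlap n p p') where
  isOpen := isOpen_overlap p p'
  subset := inter_subset_left
  smooth := contDiffOn_transition p p'
  mapsTo := fun _ hx => (transition_mem_overlap hx).1
  bijective := fun x hx => by
    have h : Function.Injective (fderiv ℝ (transition n p p') x).toLinearMap :=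
      Function.LeftInverse.injective (fderiv_transition_comp hx)
    exact ⟨h, LinearMap.injective_iff_surjective.1 h⟩
  eq := fun _ hx y => localExpr_transition F.toFun hx y

theorem inChart_zero (p : M) (x : Coord n) : F.inChart p x 0 = 0 := by
  have h := F.inChart_smul p x 0 (c := 2) two_pos
  rw [smul_zero] at h
  linarith

/-- A solution of the geodesic equation in one chart is a geodesic. -/
theorem isGeodesicOn_of_chart (p : M) {x y : ℝ → Coord n} {J : Set ℝ} (hJ : IsOpen J)
    (h : ∀ t ∈ J, x t ∈ (extChartAt (𝓡 n) p).target ∧ y t ≠ 0 ∧ HasDerivAt x (y t) t ∧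
      HasDerivAt y (-sprayVec (F.inChart p) (x t, y t)) t ∧ F.inChart p (x t) (y t) = 1) :
    F.IsGeodesicOn (fun t => (extChartAt (𝓡 n) p).symm (x t)) J := by
  have hL := F.isLocalFinsler p
  have hxc : ContinuousOn x J := fun t ht => (h t ht).2.2.1.continuousAt.continuousWithinAt
  have hyc : ContinuousOn y J := fun t ht => (h t ht).2.2.2.1.continuousAt.continuousWithinAt
  have hy1 : ContDiffOn ℝ 1 y J := by
    rw [show (1 : WithTop ℕ∞) = 0 + 1 by rfl, contDiffOn_succ_iff_deriv_of_isOpen hJ]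
    refine ⟨fun t ht => (h t ht).2.2.2.1.differentiableAt.differentiableWithinAt, by simp, ?_⟩
    refine ContDiffOn.congr (contDiffOn_zero.2 ?_) fun t ht => (h t ht).2.2.2.1.deriv
    exact (hL.contDiffOn_sprayVec.continuousOn.comp (hxc.prodMk hyc)
      fun t ht => ⟨(h t ht).1, (h t ht).2.1⟩).neg
  have hx2 : ContDiffOn ℝ 2 x J := by
    rw [show (2 : WithTop ℕ∞) = 1 + 1 by rfl, contDiffOn_succ_iff_deriv_of_isOpen hJ]
    exact ⟨fun t ht => (h t ht).2.2.1.differentiableAt.differentiableWithinAt, by simp,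
      hy1.congr fun t ht => (h t ht).2.2.1.deriv⟩
  refine ⟨?_, fun s hs p' hp' => ?_⟩
  · exact ((contMDiffOn_extChartAt_symm (I := 𝓡 n) (n := ∞) p).of_le (by norm_cast)).comp
      (contMDiffOn_iff_contDiffOn.2 hx2) fun t ht => (h t ht).1
  -- The equation is required in every chart around the point: differentiating the image curve twice
  -- produces the D²φ term that the transformation law of the spray absorbs.
  · have hT := F.isTransition p p'
    set φ := transition n p p' with hφ
    have hcurve : curveInChart (n := n) p' (fun t => (extChartAt (𝓡 n) p).symm (x t)) = fun t => φ (x t) :=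
      rfl
    have hs' : x s ∈ overlap n p p' := ⟨(h s hs).1, hp'⟩
    have hnear : ∀ᶠ t in 𝓝 s, t ∈ J ∧ x t ∈ overlap n p p' :=
      (hJ.eventually_mem hs).and ((h s hs).2.2.1.continuousAt.eventually_mem
        ((isOpen_overlap p p').mem_nhds hs'))
    have hc : ∀ t, x t ∈ overlap n p p' → ContDiffAt ℝ ∞ φ (x t) := fun t ht =>
      hT.smooth.contDiffAt (hT.isOpen.mem_nhds ht)
    have hd : ∀ t ∈ J, x t ∈ overlap n p p' →
        HasDerivAt (fun t => φ (x t)) (fderiv ℝ φ (x t) (y t)) t := fun t ht ht' =>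
      ((hc t ht').differentiableAt (by simp)).hasFDerivAt.comp_hasDerivAt t (h t ht).2.2.1
    have hd' : deriv (fun t => φ (x t)) =ᶠ[𝓝 s] fun t => fderiv ℝ φ (x t) (y t) :=
      hnear.mono fun t ht => (hd t ht.1 ht.2).deriv
    have hA : DifferentiableAt ℝ (fderiv ℝ φ) (x s) :=
      ((hc s hs').fderiv_right (m := 1) (by norm_cast)).differentiableAt one_ne_zero
    have hd2 := (hA.hasFDerivAt.comp_hasDerivAt s (h s hs).2.2.1).clm_apply (h s hs).2.2.2.1
    rw [hcurve, hd'.deriv_eq, hd'.eq_of_nhds]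
    refine ⟨(hT.eq _ hs' _).trans (h s hs).2.2.2.2, fun i => ?_⟩
    have hspray := hT.sprayVec_tangentLift hL (F.isLocalFinsler p') (z := (x s, y s))
      ⟨hs', (h s hs).2.1⟩
    have e1 : deriv (fun t => fderiv ℝ φ (x t) (y t)) s =
        -sprayVec (F.inChart p') (φ (x s), fderiv ℝ φ (x s) (y s)) := by
      refine hd2.deriv.trans ?_
      refine Eq.trans ?_ (congrArg Neg.neg hspray).symm
      rw [neg_sub, map_neg, sub_eq_add_neg]
      rfl
    rw [e1]
    exact neg_add_cancel _

theorem deriv_curveInChart {γ : ℝ → M} (hγ : F.IsGeodesicOn γ univ) {s : ℝ} {p : M}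
    (hp : γ s ∈ (chartAt (Coord n) p).source) : deriv (curveInChart (n := n) p γ) s ≠ 0 := by
  intro h0
  have h := (hγ.2 s (mem_univ s) p hp).1
  rw [h0, inChart_zero] at h
  exact zero_ne_one h

variable {F}

theorem IsGeodesicOn.continuous {γ : ℝ → M} (hγ : F.IsGeodesicOn γ univ) : Continuous γ :=
  continuousOn_univ.1 hγ.1.continuousOn

theorem IsGeodesicOn.contDiffAt_curveInChart {γ : ℝ → M} (hγ : F.IsGeodesicOn γ univ) {s : ℝ}
    {p : M} (hp : γ s ∈ (chartAt (Coord n) p).source) :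
    ContDiffAt ℝ 2 (curveInChart (n := n) p γ) s := by
  rw [← contMDiffAt_iff_contDiffAt]
  have h1 : ContMDiffAt (𝓡 n) 𝓘(ℝ, Coord n) 2 (extChartAt (𝓡 n) p) (γ s) :=
    ((contMDiffOn_extChartAt (x := p) (n := ∞) (I := 𝓡 n)).of_le (by norm_cast)).contMDiffAt
      ((chartAt (Coord n) p).open_source.mem_nhds hp)
  exact h1.comp s (hγ.1.contMDiffAt Filter.univ_mem)

/-- The quantity `Ric_{jk} dxʲ/ds dxᵏ/ds` in the chart around `p`. -/
def ricciAlong (F : FinslerStructure n M) (γ : ℝ → M) (p : M) (s : ℝ) : ℝ :=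
  ∑ j, ∑ k, ricciTensor (F.inChart p) j k
    (curveInChart (n := n) p γ s) (deriv (curveInChart (n := n) p γ) s) *
    deriv (curveInChart (n := n) p γ) s j * deriv (curveInChart (n := n) p γ) s k

/-- The velocity transforms by the derivative of the transition, so invariance of the Ricci tensor
applies. -/
theorem IsGeodesicOn.ricciAlong_eq {γ : ℝ → M} (hγ : F.IsGeodesicOn γ univ) {s : ℝ}
    {p p' : M} (hp : γ s ∈ (chartAt (Coord n) p).source)
    (hp' : γ s ∈ (chartAt (Coord n) p').source) :
    F.ricciAlong γ p' s = F.ricciAlong γ p s := by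
  have hT := F.isTransition p p'
  have hpe : γ s ∈ (extChartAt (𝓡 n) p).source := by rwa [extChartAt_source]
  have hx : curveInChart (n := n) p γ s ∈ overlap n p p' :=
    ⟨(extChartAt (𝓡 n) p).map_source hpe, by
      rw [mem_preimage, curveInChart, (extChartAt (𝓡 n) p).left_inv hpe]
      exact hp'⟩
  have hev : curveInChart (n := n) p' γ =ᶠ[𝓝 s] fun t => transition n p p' (curveInChart (n := n) p γ t) := by
    filter_upwards [hγ.continuous.continuousAt.eventually_mem
      ((isOpen_extChartAt_source p).mem_nhds hpe)] with t ht
    rw [transition, Function.comp_apply, curveInChart, curveInChart,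
      (extChartAt (𝓡 n) p).left_inv ht]
  have hd : deriv (curveInChart (n := n) p' γ) s =
      fderiv ℝ (transition n p p') (curveInChart (n := n) p γ s) (deriv (curveInChart (n := n) p γ) s) := by
    rw [hev.deriv_eq]
    exact (((hT.smooth.contDiffAt (hT.isOpen.mem_nhds hx)).differentiableAt
      (by simp)).hasFDerivAt.comp_hasDerivAt s
        ((hγ.contDiffAt_curveInChart hp).differentiableAt two_ne_zero).hasDerivAt).deriv
  have h := hT.ricciTensor_sum_tangentLift (F.isLocalFinsler p) (F.isLocalFinsler p')
    (z := (curveInChart (n := n) p γ s, deriv (curveInChart (n := n) p γ) s))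
    ⟨hx, F.deriv_curveInChart hγ hp⟩ (deriv (curveInChart (n := n) p γ) s)
  rw [ricciAlong, hd, hev.eq_of_nhds]
  exact h

theorem IsGeodesicOn.continuousAt_ricciAlong {γ : ℝ → M} (hγ : F.IsGeodesicOn γ univ) {s : ℝ}
    {p : M} (hp : γ s ∈ (chartAt (Coord n) p).source) :
    ContinuousAt (F.ricciAlong γ p) s := by
  have hL := F.isLocalFinsler p
  have hc := hγ.contDiffAt_curveInChart hp
  have hd : ContinuousAt (deriv (curveInChart (n := n) p γ)) s := by
    have h1 := (hc.fderiv_right (m := 1) le_rfl).continuousAt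
    exact h1.clm_apply continuousAt_const
  have hpe : γ s ∈ (extChartAt (𝓡 n) p).source := by rwa [extChartAt_source]
  have hz : (curveInChart (n := n) p γ s, deriv (curveInChart (n := n) p γ) s) ∈ slit (extChartAt (𝓡 n) p).target :=
    ⟨(extChartAt (𝓡 n) p).map_source hpe, F.deriv_curveInChart hγ hp⟩
  unfold ricciAlong
  have hc0 := hc.continuousAt
  clear hc
  revert hd hz hc0
  generalize curveInChart (n := n) p γ = c
  intro hd hz hc0
  have hi : ∀ i, ContinuousAt (fun t => deriv c t i) s := fun i =>
    ((EuclideanSpace.proj (𝕜 := ℝ) i).continuous.continuousAt (x := deriv c s)).comp hd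
  have hpair : ContinuousAt (fun t => (c t, deriv c t)) s := hc0.prodMk hd
  have hR : ∀ j k, ContinuousAt (fun t => ricciTensor (F.inChart p) j k (c t) (deriv c t)) s :=
    fun j k => ContinuousAt.comp (f := fun t => (c t, deriv c t))
      (g := fun z : Coord n × Coord n => ricciTensor (F.inChart p) j k z.1 z.2)
      ((hL.contDiffOn_ricciTensor j k).continuousOn.continuousAt (hL.isOpen_slit.mem_nhds hz)) hpair
  exact tendsto_finsetSum _ fun j _ => tendsto_finsetSum _ fun k _ =>
    ((hR j k).mul (hi j)).mul (hi k)

/-- Q(s) is read in the chart around γ(s), which changes with s; chart independence replaces it by a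
fixed chart near each s, which gives continuity. -/
theorem IsGeodesicOn.exists_ricci (hn : 2 ≤ n) (hRic : F.RicciPosSemidef) {γ : ℝ → M}
    (hγ : F.IsGeodesicOn γ univ) : ∃ Q : ℝ → ℝ, Continuous Q ∧ (∀ s, 0 ≤ Q s) ∧
      ∀ s p, γ s ∈ (chartAt (Coord n) p).source →
        2 * Q s = 2 / ((n : ℝ) - 1) * F.ricciAlong γ p s := by
  have hn' : (0 : ℝ) < n - 1 := by
    have : (2 : ℝ) ≤ n := by exact_mod_cast hn
    linarith
  refine ⟨fun s => 1 / ((n : ℝ) - 1) * F.ricciAlong γ (γ s) s, ?_, fun s => ?_, fun s p hp => ?_⟩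
  · refine continuous_iff_continuousAt.2 fun s => ?_
    refine ((hγ.continuousAt_ricciAlong (mem_chart_source (Coord n) (γ s))).const_mul
      (1 / ((n : ℝ) - 1))).congr ?_
    filter_upwards [hγ.continuous.continuousAt.eventually_mem
      ((chartAt (Coord n) (γ s)).open_source.mem_nhds (mem_chart_source (Coord n) (γ s)))]
      with t ht
    rw [hγ.ricciAlong_eq ht (mem_chart_source (Coord n) (γ t))]
  · refine mul_nonneg (by positivity) ?_
    exact hRic (γ s) _ _ ((extChartAt (𝓡 n) (γ s)).map_source (mem_extChartAt_source _))
      (F.deriv_curveInChart hγ (mem_chart_source (Coord n) (γ s))) _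
  · dsimp only
    rw [hγ.ricciAlong_eq hp (mem_chart_source (Coord n) (γ s))]
    ring

theorem exists_poincareDist_lt {ε : ℝ} (hε : 0 < ε) :
    ∃ R : ℝ, 1 < R ∧ ∀ b, |b| ≤ 1 / R → poincareDist 0 b < ε := by
  have hc : ContinuousAt (poincareDist 0) 0 := by
    unfold poincareDist
    refine ContinuousAt.abs (ContinuousAt.log (ContinuousAt.div ?_ ?_ (by norm_num)) (by norm_num))
    all_goals fun_prop
  have h0 : poincareDist 0 0 = 0 := by simp [poincareDist]
  obtain ⟨η, hη, h⟩ := Metric.continuousAt_iff.1 hc ε hε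
  refine ⟨max 2 (2 / η), lt_max_of_lt_left one_lt_two, fun b hb => ?_⟩
  have hb' : |b| < η := by
    refine hb.trans_lt ?_
    rw [div_lt_iff₀ (by positivity)]
    have := mul_le_mul_of_nonneg_left (le_max_right 2 (2 / η)) hη.le
    rw [mul_div_cancel₀ _ hη.ne'] at this
    linarith
  have := h (x := b) (by rwa [Real.dist_eq, sub_zero])
  rw [h0, Real.dist_eq, sub_zero] at this
  exact (le_abs_self _).trans_lt this

/-- Only R depends on ε, while δ is fixed beforehand. The projective map is γ composed with the
inverse of π. -/
theorem IsGeodesicOn.exists_shortlyJoined (hn : 2 ≤ n) (hRic : F.RicciPosSemidef) {γ : ℝ → M}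
    (hγ : F.IsGeodesicOn γ univ) (a : ℝ) :
    ∃ δ > 0, ∀ b, |b - a| ≤ δ → F.ShortlyJoined (γ a) (γ b) := by
  obtain ⟨Q, hQ, hQ0, hQR⟩ := hγ.exists_ricci hn hRic
  obtain ⟨δ, hδ, h⟩ := exists_schwarzian_eq hQ hQ0 a
  refine ⟨δ, hδ, fun b hb ε hε => ?_⟩
  obtain ⟨R, hR, hRε⟩ := exists_poincareDist_lt hε
  obtain ⟨J, π, hJ, hJc, hπ, hπ', hS, hbij, hπa, hπδ⟩ := h R hR
  obtain ⟨haJ, -⟩ := hπδ a (by simpa using hδ.le)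
  obtain ⟨hbJ, hπb⟩ := hπδ b hb
  have hinv : ∀ s ∈ J, γ (Function.invFunOn π J (π s)) = γ s := fun s hs => by
    rw [hbij.injOn.leftInvOn_invFunOn hs]
  refine ⟨fun t => γ (Function.invFunOn π J t), π a, π b, ?_, hbij.mapsTo haJ, hbij.mapsTo hbJ,
    hinv a haJ, hinv b hbJ, ?_⟩
  · refine ⟨J, γ, π, hJ, hJc, ⟨hγ.1.mono (subset_univ J), fun s _ => hγ.2 s (mem_univ s)⟩,
      ⟨hπ, hπ', fun s hs p hp => ?_⟩, hbij, hinv⟩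
    rw [hS s hs]
    exact hQR s p hp
  · rw [hπa]
    exact hRε _ hπb

/-- Connectedness of the real line. Both directions are needed locally, hence the symmetry of
`ShortlyJoined`. -/
theorem IsGeodesicOn.transGen (hn : 2 ≤ n) (hRic : F.RicciPosSemidef) {γ : ℝ → M}
    (hγ : F.IsGeodesicOn γ univ) (a b : ℝ) :
    Relation.TransGen F.ShortlyJoined (γ a) (γ b) := by
  refine PreconnectedSpace.induction₂' (fun a b => Relation.TransGen F.ShortlyJoined (γ a) (γ b))
    (fun a => ?_) ⟨fun _ _ _ h1 h2 => h1.trans h2⟩ a b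
  obtain ⟨δ, hδ, h⟩ := hγ.exists_shortlyJoined hn hRic a
  filter_upwards [Metric.ball_mem_nhds a hδ] with b hb
  rw [Metric.mem_ball, Real.dist_eq] at hb
  exact ⟨.single (h b hb.le), .single (h b hb.le).symm⟩

/-- Every point can be joined to all nearby points by complete geodesics. -/
theorem exists_geodesic (hcomplete : F.IsComplete) (p : M) :
    ∃ r > 0, ∀ q, q ≠ extChartAt (𝓡 n) p p → dist q (extChartAt (𝓡 n) p p) < r →
      ∃ (γ : ℝ → M) (c : ℝ), F.IsGeodesicOn γ univ ∧ γ 0 = p ∧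
        γ c = (extChartAt (𝓡 n) p).symm q := by
  have hL := F.isLocalFinsler p
  obtain ⟨r, hr, h⟩ := exists_boundary_value hL.isOpen (mem_extChartAt_target (I := 𝓡 n) p)
    (hL.contDiffOn_sprayVec.of_le (by norm_cast)) (fun x hx y hy c hc =>
      hL.sprayVec_smul hc (z := (x, y)) ⟨hx, hy⟩)
  refine ⟨r, hr, fun q hq hqr => ?_⟩
  obtain ⟨x, y, hx0, hx1, hxy⟩ := h q hq hqr
  have h0 : (0 : ℝ) ∈ Ioo (-1 : ℝ) 2 := by norm_num
  have hz : ∀ t ∈ Ioo (-1 : ℝ) 2, (x t, y t) ∈ slit (extChartAt (𝓡 n) p).target := fun t ht =>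
    ⟨(hxy t ht).1, (hxy t ht).2.1⟩
  have hconst : ∀ t ∈ Ioo (-1 : ℝ) 2, sq (F.inChart p) (x t, y t) =
      sq (F.inChart p) (x 0, y 0) := by
    have hd : ∀ t ∈ Ioo (-1 : ℝ) 2, HasDerivAt (fun t => sq (F.inChart p) (x t, y t)) 0 t := by
      intro t ht
      have h1 := (hL.differentiableAt_sq (hz t ht)).hasFDerivAt.comp_hasDerivAt t
        ((hxy t ht).2.2.1.prodMk (hxy t ht).2.2.2)
      rwa [hL.fderiv_sq_spray (hz t ht)] at h1
    intro t ht
    exact isOpen_Ioo.is_const_of_deriv_eq_zero isPreconnected_Ioo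
      (fun t ht => (hd t ht).differentiableAt.differentiableWithinAt)
      (fun t ht => (hd t ht).deriv) ht h0
  -- F is conserved along the solution, so its constant speed c can be normalised by s = ct; q is
  -- then reached at arc length c.
  set c := F.inChart p (x 0) (y 0) with hc
  have hnn : ∀ t, 0 ≤ F.inChart p (x t) (y t) := fun t => F.nonneg _
  have hc0 : 0 < c := by
    have := hL.sq_pos (hz 0 h0)
    exact lt_of_le_of_ne (hnn 0) fun h0 => by simp [sq, ← hc, ← h0] at this
  have hspeed : ∀ t ∈ Ioo (-1 : ℝ) 2, F.inChart p (x t) (y t) = c := fun t ht =>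
    (pow_left_inj₀ (hnn t) hc0.le two_ne_zero).1 (hconst t ht)
  have hmem : ∀ s ∈ Ioo (-c) (2 * c), c⁻¹ * s ∈ Ioo (-1 : ℝ) 2 := by
    intro s hs
    rw [inv_mul_eq_div]
    exact ⟨by rw [lt_div_iff₀ hc0]; linarith [hs.1], by rw [div_lt_iff₀ hc0]; linarith [hs.2]⟩
  have hscale : ∀ s, HasDerivAt (fun s : ℝ => c⁻¹ * s) c⁻¹ s := fun s => by
    simpa using (hasDerivAt_id s).const_mul c⁻¹
  have hgeo := F.isGeodesicOn_of_chart p (x := fun s => x (c⁻¹ * s))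
    (y := fun s => c⁻¹ • y (c⁻¹ * s)) (J := Ioo (-c) (2 * c)) isOpen_Ioo (fun s hs => by
      obtain ⟨h1, h2, h3, h4⟩ := hxy _ (hmem s hs)
      refine ⟨h1, smul_ne_zero (inv_ne_zero hc0.ne') h2, h3.scomp s (hscale s), ?_, ?_⟩
      · refine ((h4.scomp s (hscale s)).const_smul c⁻¹).congr_deriv ?_
        rw [hL.sprayVec_smul (inv_pos.2 hc0) (hz _ (hmem s hs)), smul_smul, smul_neg, pow_two]
      · rw [F.inChart_smul p _ _ (inv_pos.2 hc0), hspeed _ (hmem s hs), inv_mul_cancel₀ hc0.ne'])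
  have h0J : (0 : ℝ) ∈ Ioo (-c) (2 * c) := ⟨by linarith, by linarith⟩
  have hcJ : c ∈ Ioo (-c) (2 * c) := ⟨by linarith, by linarith⟩
  obtain ⟨γ, hγ, hγe⟩ := hcomplete _ _ isOpen_Ioo ordConnected_Ioo ⟨0, h0J⟩ hgeo
  refine ⟨γ, c, hγ, ?_, ?_⟩
  · rw [hγe h0J]
    simp only [mul_zero, hx0]
    exact extChartAt_to_inv p
  · rw [hγe hcJ]
    simp only [inv_mul_cancel₀ hc0.ne', hx1]

theorem transGen_shortlyJoined [ConnectedSpace M] (hn : 2 ≤ n) (hcomplete : F.IsComplete)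
    (hRic : F.RicciPosSemidef) (x y : M) : Relation.TransGen F.ShortlyJoined x y := by
  refine PreconnectedSpace.induction₂' (Relation.TransGen F.ShortlyJoined)
    (fun p => ?_) ⟨fun _ _ _ h1 h2 => h1.trans h2⟩ x y
  obtain ⟨r, hr, h⟩ := F.exists_geodesic hcomplete p
  have : Nontrivial (Coord n) := by
    have : Nonempty (Fin n) := ⟨⟨0, by omega⟩⟩
    infer_instance
  -- An auxiliary second point provides a geodesic through p. It serves the case q = p, where a
  -- segment is still required because the closure is not reflexive.
  obtain ⟨q₀, hq₀r, hq₀⟩ : ∃ q, dist q (extChartAt (𝓡 n) p p) < r ∧ q ≠ extChartAt (𝓡 n) p p := by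
    obtain ⟨v, hv⟩ := exists_norm_eq (Coord n) (half_pos hr).le
    refine ⟨extChartAt (𝓡 n) p p + v, by rw [dist_self_add_left, hv]; linarith, fun h => ?_⟩
    rw [add_eq_left] at h
    rw [h, norm_zero] at hv
    linarith
  filter_upwards [extChartAt_source_mem_nhds (I := 𝓡 n) p,
    (continuousAt_extChartAt (I := 𝓡 n) p).eventually_mem (Metric.ball_mem_nhds _ hr)]
    with q hqs hqr
  by_cases hqp : q = p
  · obtain ⟨γ, c, hγ, h0, -⟩ := h q₀ hq₀ hq₀r
    have := hγ.transGen hn hRic 0 0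
    rw [h0] at this
    rw [hqp]
    exact ⟨this, this⟩
  · obtain ⟨γ, c, hγ, h0, hγc⟩ := h (extChartAt (𝓡 n) p q)
      (fun he => hqp ((extChartAt (𝓡 n) p).injOn hqs (mem_extChartAt_source p) he)) hqr
    rw [(extChartAt (𝓡 n) p).left_inv hqs] at hγc
    have h1 := hγ.transGen hn hRic 0 c
    have h2 := hγ.transGen hn hRic c 0
    rw [h0, hγc] at h1 h2
    exact ⟨h1, h2⟩

end Geodesics
end FinslerStructure

end Finsler

end

theorem theorem3 {n : ℕ} (hn : 2 ≤ n) {M : Type*} [TopologicalSpace M] [T2Space M]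
    [ConnectedSpace M] [ChartedSpace (Finsler.Coord n) M] [IsManifold (𝓡 n) ∞ M]
    (F : Finsler.FinslerStructure n M) (hcomplete : F.IsComplete)
    (hRic : F.RicciPosSemidef) :
    ∀ x y : M, F.pseudoDist x y = 0 :=
  fun x y => Finsler.FinslerStructure.pseudoDist_eq_zero_of_transGen
    (Finsler.FinslerStructure.transGen_shortlyJoined hn hcomplete hRic x y)
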